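/- **Theorem (an example of non-quenched convergence).** There exist a probability space $(\Omega,\mathcal F,\mathbb P)$, an invertible, bimeasurable, measure-preserving, ergodic transformation $T:\Omega\to\Omega$, a sub-sigma-algebra $\mathcal F_0\subset\mathcal F$ with $\mathcal F_0\subset T^{-1}\mathcal F_0$, and an $\mathcal F_0$-measurable real random variable $X_0\in L^2_{\mathbb P}$ such that, with $X_k:=X_0\circ T^k$, $\mathcal F_k:=T^{-k}\mathcal F_0$ ($k\in\mathbb Z$), $E_0:=E[\,\cdot\,|\mathcal F_0]$ and $$S_n(\theta):=\sum_{k=0}^{n-1}X_k e^{ik\theta},\qquad Z_n(\theta):=\frac{S_n(\theta)}{\sqrt n}\qquad(n\ge 1),$$ the following hold. 1. (Hypotheses of the Peligrad–Wu central limit theorem.) The sigma-algebra $\sigma(\bigcup_{k}\mathcal F_k)$ is countably generated; the process is regular, that is, $E\big[|E[X_0|\mathcal F_{-k}]|^2\big]\to0$ as $k\to\infty$; and it has a spectral density, that is, there is an integrable function $\sigma^2:[0,2\pi)\to[0,\infty)$ with $\frac1{2\pi}\int_0^{2\pi}\sigma^2(\theta)e^{ik\theta}\,d\theta=\operatorname{Cov}(X_0,X_k)$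 for every $k\in\mathbb Z$. 2. (Adapted linear process.) There are real i.i.d. centered square-integrable variables $\xi_k=\xi_0\circ T^k$ ($k\in\mathbb Z$) with $\mathcal F_0=\sigma(\xi_j:j\le0)$, and real numbers $(a_j)_{j\ge0}$ with $\sum_j a_j^2<\infty$, such that $X_k=\sum_{j\ge0}a_j\xi_{k-j}$ in $L^2_{\mathbb P}$ for every $k\in\mathbb Z$. 3. $E_0$ is regular, that is, it admits a decomposition: a family $(\mathbb P_\omega)_{\omega\in\Omega}$ of probability measures on $(\Omega,\mathcal F)$ such that, for every $\mathbb P$-integrable $Y:\Omega\to\mathbb R$, the function $\omega\mapsto\int Y\,d\mathbb P_\omega$ (set to $0$ where the integral does not make sense) is an $\mathcal F_0$-measurable version of $E_0Y$. 4. For every $\theta\in[0,2\pi)$, $\displaystyle\limsup_{n\to\infty}\frac{|E_0S_n(\theta)|}{\sqrt n}=\infty$ $\mathbb P$-almost surely. 5. For every decomposition $(\mathbb P_\omega)_{\omega\in\Omega}$ of $E_0$, every $\theta\in[0,2\pi)$ and $\mathbb P$-almost every $\omega\in\Omega$ (the exceptional null set may depend on $\theta$), the sequence $(Z_n(\theta))_{n\ge1}$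 does not converge in distribution under $\mathbb P_\omega$ to any probability law on $\mathbb C$. -/

import Mathlib

open MeasureTheory ProbabilityTheory Filter Topology

namespace QuenchedDFT

variable {Ω : Type*}

/-- The `k`-fold composition `T ^ k` of an invertible bimeasurable map, for `k : ℤ`. -/
def iter [MeasurableSpace Ω] (T : Ω ≃ᵐ Ω) (k : ℤ) : Ω → Ω :=
  ⇑((T.toEquiv : Equiv.Perm Ω) ^ k)

/-- The process `X k = X₀ ∘ T ^ k`, `k : ℤ`, generated by `X₀` and `T`. -/
def process [MeasurableSpace Ω] (T : Ω ≃ᵐ Ω) (X₀ : Ω → ℝ) (k : ℤ) : Ω → ℝ :=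
  fun ω => X₀ (iter T k ω)

/-- The sigma-algebra `F k = T ^ (-k) F₀ = {T ^ (-k) B : B ∈ F₀}`. -/
@[reducible]
def sigmaAt (F₀ : MeasurableSpace Ω) [MeasurableSpace Ω] (T : Ω ≃ᵐ Ω) (k : ℤ) :
    MeasurableSpace Ω :=
  F₀.comap (iter T k)

/-- `F₀` generates a `T`-filtration: `T` preserves `P`, `F₀` is a sub-sigma-algebra, and
`F₀ ⊆ T⁻¹ F₀`. -/
structure IsTFiltration (F₀ : MeasurableSpace Ω) [mΩ : MeasurableSpace Ω] (P : Measure Ω)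
    (T : Ω ≃ᵐ Ω) : Prop where
  measurePreserving : MeasurePreserving T P P
  le : F₀ ≤ mΩ
  mono : F₀ ≤ sigmaAt F₀ T 1

/-- Regularity of the process with respect to `(F k)`: `E[X₀ | F (-k)] → 0` in `L²`. -/
def IsRegularProcess (F₀ : MeasurableSpace Ω) [MeasurableSpace Ω] (P : Measure Ω)
    (T : Ω ≃ᵐ Ω) (X₀ : Ω → ℝ) : Prop :=
  Tendsto (fun k : ℕ => ∫ ω, |(P[X₀ | sigmaAt F₀ T (-(k : ℤ))]) ω| ^ 2 ∂P) atTop (𝓝 0)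

/-- `s` is a spectral density, with respect to the normalized Lebesgue measure on `[0, 2π)`,
of the real-valued process `X`. -/
structure IsSpectralDensity [MeasurableSpace Ω] (P : Measure Ω) (X : ℤ → Ω → ℝ)
    (s : ℝ → ℝ) : Prop where
  nonneg : ∀ θ, 0 ≤ s θ
  integrableOn : IntegrableOn s (Set.Ico 0 (2 * Real.pi))
  fourier : ∀ k : ℤ,
    (1 / (2 * (Real.pi : ℂ))) * ∫ θ in Set.Ico 0 (2 * Real.pi),
        (s θ : ℂ) * Complex.exp (Complex.I * (k : ℂ) * (θ : ℂ))
      = ((cov[X 0, X k; P] : ℝ) : ℂ)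

/-- The hypotheses of the central limit theorem of Peligrad and Wu for discrete Fourier
transforms: a real-valued, square-integrable, ergodic process, adapted to a `T`-filtration whose
right sigma-algebra is countably generated, regular, and with a spectral density. -/
structure PeligradWuHypotheses (F₀ : MeasurableSpace Ω) [MeasurableSpace Ω] (P : Measure Ω)
    (T : Ω ≃ᵐ Ω) (X₀ : Ω → ℝ) : Prop where
  isTFiltration : IsTFiltration F₀ P T
  ergodic : Ergodic T P
  countablyGenerated : @MeasurableSpace.CountablyGenerated Ω (⨆ k : ℤ, sigmaAt F₀ T k)
  adapted : Measurable[F₀] X₀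
  memLp : MemLp X₀ 2 P
  regular : IsRegularProcess F₀ P T X₀
  spectralDensity : ∃ s : ℝ → ℝ, IsSpectralDensity P (process T X₀) s

/-- `X₀ ∘ T ^ k = ∑_{j ≥ 0} a j * ξ (k - j)` in `L²` for every `k`, where `a` is square-summable
and the `ξ k = ξ 0 ∘ T ^ k` are real i.i.d. centered square-integrable variables with
`F₀ = σ(ξ j, j ≤ 0)`. -/
structure IsAdaptedLinearProcess (F₀ : MeasurableSpace Ω) [MeasurableSpace Ω] (P : Measure Ω)
    (T : Ω ≃ᵐ Ω) (X₀ : Ω → ℝ) (ξ : ℤ → Ω → ℝ) (a : ℕ → ℝ) : Prop where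
  measurable : ∀ k, Measurable (ξ k)
  iIndepFun : iIndepFun ξ P
  identDistrib : ∀ k, IdentDistrib (ξ k) (ξ 0) P P
  memLp : MemLp (ξ 0) 2 P
  centered : ∫ ω, ξ 0 ω ∂P = 0
  shift : ∀ k, ξ k = process T (ξ 0) k
  past_eq : F₀ = ⨆ j : Set.Iic (0 : ℤ), MeasurableSpace.comap (ξ j) inferInstance
  summable : Summable (fun j => a j ^ 2)
  series : ∀ k : ℤ, Tendsto
    (fun N : ℕ => eLpNorm
      (fun ω => process T X₀ k ω - ∑ j ∈ Finset.range N, a j * ξ (k - (j : ℤ)) ω) 2 P)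
    atTop (𝓝 0)

/-- `Q` is a decomposition of the conditional expectation `E[· | F₀]`. The Bochner integral is
zero when the integral does not make sense. -/
def IsDecomposition (F₀ : MeasurableSpace Ω) [MeasurableSpace Ω] (P : Measure Ω)
    (Q : Ω → ProbabilityMeasure Ω) : Prop :=
  ∀ Y : Ω → ℝ, Measurable Y → Integrable Y P →
    Measurable[F₀] (fun ω => ∫ z, Y z ∂(Q ω : Measure Ω)) ∧
      (fun ω => ∫ z, Y z ∂(Q ω : Measure Ω)) =ᵐ[P] P[Y | F₀]

/-- `E[· | F₀]` is regular: it admits a decomposition. -/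
def IsRegularCondExp (F₀ : MeasurableSpace Ω) [MeasurableSpace Ω] (P : Measure Ω) : Prop :=
  ∃ Q : Ω → ProbabilityMeasure Ω, IsDecomposition F₀ P Q

/-- The `n`-th discrete Fourier transform `S_n(θ) = ∑_{k < n} X k * exp (i k θ)`. -/
noncomputable def dft (X : ℤ → Ω → ℝ) (n : ℕ) (θ : ℝ) : Ω → ℂ :=
  fun ω => ∑ k ∈ Finset.range n,
    (X (k : ℤ) ω : ℂ) * Complex.exp (Complex.I * (k : ℂ) * (θ : ℂ))

/-- The normalized transform `Z_n(θ) = S_n(θ) / √n`. -/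
noncomputable def normalizedDft (X : ℤ → Ω → ℝ) (n : ℕ) (θ : ℝ) : Ω → ℂ :=
  fun ω => dft X n θ ω / ((Real.sqrt n : ℝ) : ℂ)

/-- `Z n` converges in distribution, under the probability measure `Q`, to some probability law
on `ℂ`. -/
def HasLimitInDistribution [MeasurableSpace Ω] (Q : ProbabilityMeasure Ω) (Z : ℕ → Ω → ℂ) :
    Prop :=
  ∃ ν : ProbabilityMeasure ℂ,
    TendstoInDistribution Z atTop (id : ℂ → ℂ) (fun _ => (Q : Measure Ω)) (ν : Measure ℂ)

end QuenchedDFT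

/-!
The example is a causal linear process over the two-sided shift of i.i.d. standard Gaussian
variables `ξ k`, with past sigma-algebra `F₀ = σ(ξ j, j ≤ 0)` and `X k = ∑ a m * ξ (k - m)`. The
coefficients are sparse, `a (x l) = 2 ^ (-l)` at positions `x l` that are very far apart, and zero
elsewhere. As `∑ |a m| < ∞`, the series converge absolutely almost surely and in `L²`, the process
is regular, and `|∑ a m * exp (i m θ)| ^ 2` is a spectral density. The shift is ergodic because it
is mixing (`tendsto_measure_inter_translate`).

The conditional expectation `E[S_n(θ) | F₀]` is the part `pastDft a n θ` of `S_n(θ)` that depends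
on the coordinates with index `≤ 0`. Its increment over a dyadic block of times
`[2 ^ j, 2 ^ (j + 1))` contains the term `2 ^ (-l) * ∑ exp (i k θ) * ξ (k - x l)`, which has
variance of order `4 ^ (-l) * 2 ^ j` and, as long as no other coefficient interferes, is
independent of all other contributions. So each block is an independent trial for the increment
to exceed `l * √(2 ^ j)`, and its probability of success is bounded below by a Gaussian tail that
depends on `l` only: not on `j`, not on `θ`, and not on the value of the other contributions
(`gaussianReal_abs_add_lt_le`). If the spike at `x l` is isolated at a scale `2 ^ (J l)` with
`J l` large enough, then with probability at least `1 - 2 ^ (-l)` one of the `J l` trials succeeds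
(`measure_forall_pastDft_lt_le`), and by Borel-Cantelli `|E[S_n(θ) | F₀]| / √n` is almost surely
unbounded (`exists_coefficients`).

Conditionally on `F₀` the transform is `S_n(θ) = c + W` with `c = E[S_n(θ) | F₀]` and `W` symmetric,
as changing the sign of the future innovations preserves the law. Since `|c + W|` or `|c - W|` is at
least `|c|`, one has `P(|S_n(θ)| ≥ K √n | F₀) ≥ 1/2` whenever `|c| ≥ K √n`
(`half_le_condExp_dft`). This happens for infinitely many `n`, for every `K`, so `Z_n(θ)` is not
tight under the conditional laws and cannot converge in distribution.
-/

namespace QuenchedDFT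

/-! ### Setwise convergence of measures from a generating π-system -/

/-- Setwise convergence of measures that are dominated by a fixed finite measure may be checked
on a generating π-system. -/
theorem tendsto_measureReal_of_isPiSystem {Ω : Type*} [mΩ : MeasurableSpace Ω] {P ν : Measure Ω}
    {μ : ℕ → Measure Ω} [IsFiniteMeasure P] [IsFiniteMeasure ν] (hle : ∀ n, μ n ≤ P)
    {C : Set (Set Ω)} (hgen : mΩ = MeasurableSpace.generateFrom C) (hC : IsPiSystem C)
    (huniv : Tendsto (fun n => (μ n).real Set.univ) atTop (𝓝 (ν.real Set.univ)))
    (h : ∀ s ∈ C, Tendsto (fun n => (μ n).real s) atTop (𝓝 (ν.real s)))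
    {s : Set Ω} (hs : MeasurableSet s) :
    Tendsto (fun n => (μ n).real s) atTop (𝓝 (ν.real s)) := by
  have hfin : ∀ n, IsFiniteMeasure (μ n) := fun n => isFiniteMeasure_of_le P (hle n)
  induction s, hs using MeasurableSpace.induction_on_inter hgen hC with
  | empty => simp
  | basic t ht => exact h t ht
  | compl t ht ih =>
    simp only [measureReal_compl ht]
    exact huniv.sub ih
  | iUnion f hd hm ih =>
    have key : ∀ ρ : Measure Ω, IsFiniteMeasure ρ →
        ρ.real (⋃ i, f i) = ∑' i, ρ.real (f i) := by
      intro ρ _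
      simp only [measureReal_def]
      rw [measure_iUnion hd hm, ENNReal.tsum_toReal_eq (fun i => measure_ne_top _ _)]
    simp only [key _ (hfin _), key ν inferInstance]
    refine tendsto_tsum_of_dominated_convergence (bound := fun i => P.real (f i)) ?_ ih ?_
    · have : ∑' i, P (f i) ≠ ⊤ := by
        rw [← measure_iUnion hd hm]; exact measure_ne_top _ _
      exact ENNReal.summable_toReal this
    · refine Eventually.of_forall fun n i => ?_
      rw [Real.norm_of_nonneg measureReal_nonneg]
      exact ENNReal.toReal_mono (measure_ne_top _ _) (hle n _)

/-! ### The Gaussian Bernoulli shift -/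

/-- The law of a two-sided sequence of independent standard Gaussian variables. -/
noncomputable def gaussianPath : Measure (ℤ → ℝ) :=
  Measure.infinitePi fun _ => gaussianReal 0 1

instance : IsProbabilityMeasure gaussianPath := by
  unfold gaussianPath; infer_instance

/-- The left shift `(T ω) i = ω (i + 1)` on two-sided real sequences. -/
def shift : (ℤ → ℝ) ≃ᵐ (ℤ → ℝ) where
  toFun ω i := ω (i + 1)
  invFun ω i := ω (i - 1)
  left_inv ω := by funext i; simp
  right_inv ω := by funext i; simp
  measurable_toFun := by simp only [Equiv.coe_fn_mk]; fun_prop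
  measurable_invFun := by simp only [Equiv.coe_fn_symm_mk]; fun_prop

theorem iter_shift (k : ℤ) (ω : ℤ → ℝ) (i : ℤ) : iter shift k ω i = ω (i + k) := by
  have hone : ∀ ω : ℤ → ℝ, (shift.toEquiv : Equiv.Perm (ℤ → ℝ)) ω = fun i => ω (i + 1) :=
    fun _ => rfl
  have hinv : ∀ ω : ℤ → ℝ, (shift.toEquiv : Equiv.Perm (ℤ → ℝ))⁻¹ ω = fun i => ω (i - 1) :=
    fun _ => rfl
  unfold iter
  induction k using Int.induction_on generalizing ω i with
  | zero => simp
  | succ k ih => rw [zpow_add_one, Equiv.Perm.mul_apply, ih, hone]; ring_nf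
  | pred k ih => rw [zpow_sub_one, Equiv.Perm.mul_apply, ih, hinv]; ring_nf

theorem process_shift (X : (ℤ → ℝ) → ℝ) (k : ℤ) (ω : ℤ → ℝ) :
    process shift X k ω = X fun i => ω (i + k) := by
  unfold process
  congr 1
  funext i
  exact iter_shift k ω i

theorem measurePreserving_translate (k : ℤ) :
    MeasurePreserving (fun (ω : ℤ → ℝ) i => ω (i + k)) gaussianPath gaussianPath :=
  ⟨by fun_prop, Measure.map_infinitePi_infinitePi_of_inj
    (P := fun _ : ℤ => gaussianReal 0 1) (f := fun i : ℤ => i + k) (add_left_injective k)⟩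

theorem measurePreserving_shift : MeasurePreserving shift gaussianPath gaussianPath :=
  measurePreserving_translate 1

theorem iIndepFun_coord : iIndepFun (fun (i : ℤ) (ω : ℤ → ℝ) => ω i) gaussianPath :=
  iIndepFun_infinitePi (X := fun _ x => x) fun _ => measurable_id

theorem map_coord (i : ℤ) : gaussianPath.map (fun ω => ω i) = gaussianReal 0 1 :=
  Measure.infinitePi_map_eval _ i

/-! ### Sigma-algebras generated by coordinates -/

/-- The sigma-algebra generated by the coordinates with index in `S`. -/
@[reducible]
def coordSigma (S : Set ℤ) : MeasurableSpace (ℤ → ℝ) :=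
  ⨆ i : S, MeasurableSpace.comap (fun ω : ℤ → ℝ => ω i) inferInstance

theorem measurable_coord {S : Set ℤ} {i : ℤ} (hi : i ∈ S) :
    Measurable[coordSigma S] fun ω : ℤ → ℝ => ω i :=
  Measurable.iSup' ⟨i, hi⟩ (comap_measurable _)

theorem coordSigma_le (S : Set ℤ) : coordSigma S ≤ MeasurableSpace.pi :=
  iSup_le fun i => (measurable_pi_apply (i : ℤ)).comap_le

theorem coordSigma_mono {S T : Set ℤ} (h : S ⊆ T) : coordSigma S ≤ coordSigma T :=
  iSup_le fun i => (measurable_coord (h i.2)).comap_le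

theorem indep_coordSigma {S T : Set ℤ} (h : Disjoint S T) :
    Indep (coordSigma S) (coordSigma T) gaussianPath := by
  have := indep_iSup_of_disjoint (m := fun i : ℤ =>
    MeasurableSpace.comap (fun ω : ℤ → ℝ => ω i) inferInstance)
    (fun i => (measurable_pi_apply i).comap_le) iIndepFun_coord h
  rwa [iSup_subtype', iSup_subtype'] at this

theorem sigmaAt_coordSigma (k : ℤ) :
    sigmaAt (coordSigma (Set.Iic 0)) shift k = coordSigma (Set.Iic k) := by
  have hcomp : ∀ i : ℤ, (fun ω : ℤ → ℝ => ω i) ∘ iter shift k = fun ω => ω (i + k) :=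
    fun i => funext fun ω => iter_shift k ω i
  unfold sigmaAt
  rw [MeasurableSpace.comap_iSup]
  simp only [MeasurableSpace.comap_comp, hcomp]
  refine le_antisymm (iSup_le fun i => ?_) (iSup_le fun i => ?_)
  · exact (measurable_coord (by have := i.2; simp only [Set.mem_Iic] at this ⊢; omega)).comap_le
  · refine le_iSup_of_le ⟨i - k, by have := i.2; simp only [Set.mem_Iic] at this ⊢; omega⟩ ?_
    simp

theorem iSup_sigmaAt :
    ⨆ k : ℤ, sigmaAt (coordSigma (Set.Iic 0)) shift k = MeasurableSpace.pi := by
  simp only [sigmaAt_coordSigma]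
  refine le_antisymm (iSup_le fun k => coordSigma_le _) (iSup_le fun i => ?_)
  exact le_iSup_of_le i (measurable_coord (Set.mem_Iic.2 le_rfl)).comap_le

theorem measurableSet_cylinder_coordSigma (I : Finset ℤ) {S : Set (I → ℝ)}
    (hS : MeasurableSet S) : MeasurableSet[coordSigma I] (cylinder I S) := by
  have : Measurable[coordSigma I] (I.restrict (π := fun _ => ℝ)) :=
    @measurable_pi_lambda _ _ _ (coordSigma I) _ _ fun i => measurable_coord i.2
  exact this hS

/-! ### Mixing and ergodicity of the shift -/

/-- Cylinder sets become independent once they are shifted far enough apart. -/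
theorem eventually_measure_inter_translate {B C : Set (ℤ → ℝ)}
    (hB : B ∈ measurableCylinders fun _ : ℤ => ℝ) (hC : C ∈ measurableCylinders fun _ : ℤ => ℝ) :
    ∀ᶠ n : ℕ in atTop, gaussianPath.real (B ∩ (fun ω i => ω (i + n)) ⁻¹' C)
      = gaussianPath.real B * gaussianPath.real C := by
  obtain ⟨I, S, hS, rfl⟩ := (mem_measurableCylinders _).1 hB
  obtain ⟨J, U, hU, rfl⟩ := (mem_measurableCylinders _).1 hC
  have hbound : ∀ᶠ n : ℕ in atTop, ∀ j ∈ J, ∀ i ∈ I, i < j + n := by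
    refine (Finset.eventually_all _).2 fun j _ => (Finset.eventually_all _).2 fun i _ => ?_
    filter_upwards [eventually_gt_atTop (i - j).toNat] with n hn
    omega
  filter_upwards [hbound] with n hn
  have hmeas : MeasurableSet[coordSigma ((· + (n : ℤ)) '' (J : Set ℤ))]
      ((fun (ω : ℤ → ℝ) i => ω (i + n)) ⁻¹' cylinder J U) := by
    have h : Measurable[coordSigma ((· + (n : ℤ)) '' (J : Set ℤ)), MeasurableSpace.pi]
        (fun (ω : ℤ → ℝ) (j : J) => ω (j + n)) :=
      @measurable_pi_lambda _ _ _ (coordSigma _) _ _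
        fun j => measurable_coord (Set.mem_image_of_mem _ j.2)
    exact h hU
  have hdisj : Disjoint (I : Set ℤ) ((· + (n : ℤ)) '' (J : Set ℤ)) := by
    rw [Set.disjoint_left]
    rintro i hi ⟨j, hj, rfl⟩
    exact lt_irrefl _ (hn j hj _ hi)
  have := (Indep_iff _ _ _).1 (indep_coordSigma hdisj) _ _
    (measurableSet_cylinder_coordSigma I hS) hmeas
  rw [(measurePreserving_translate n).measure_preimage
    (hU.cylinder (α := fun _ => ℝ) J).nullMeasurableSet] at this
  simp only [measureReal_def, this, ENNReal.toReal_mul]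

theorem tendsto_measure_inter_translate {B C : Set (ℤ → ℝ)} (hB : MeasurableSet B)
    (hC : MeasurableSet C) :
    Tendsto (fun n : ℕ => gaussianPath.real (B ∩ (fun ω i => ω (i + n)) ⁻¹' C)) atTop
      (𝓝 (gaussianPath.real B * gaussianPath.real C)) := by
  have hgen := (generateFrom_measurableCylinders (α := fun _ : ℤ => ℝ)).symm
  have hpi := isPiSystem_measurableCylinders (α := fun _ : ℤ => ℝ)
  have htr : ∀ (n : ℕ) {D : Set (ℤ → ℝ)}, MeasurableSet D →
      gaussianPath.real ((fun ω i => ω (i + n)) ⁻¹' D) = gaussianPath.real D := fun n D hD => by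
    rw [measureReal_def, (measurePreserving_translate n).measure_preimage hD.nullMeasurableSet,
      measureReal_def]
  have hm : ∀ n : ℕ, Measurable fun (ω : ℤ → ℝ) (i : ℤ) => ω (i + n) := fun n => by fun_prop
  -- With a cylinder `C` fixed, extend from cylinders `B` to measurable `B`.
  have step : ∀ D ∈ measurableCylinders (fun _ : ℤ => ℝ), ∀ B : Set (ℤ → ℝ), MeasurableSet B →
      Tendsto (fun n : ℕ => gaussianPath.real (B ∩ (fun ω i => ω (i + n)) ⁻¹' D)) atTop
        (𝓝 (gaussianPath.real B * gaussianPath.real D)) := by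
    intro D hD B hB
    have hDm : MeasurableSet D := MeasurableSet.of_mem_measurableCylinders hD
    have hfin := Measure.smul_finite gaussianPath (measure_ne_top gaussianPath D)
    have := tendsto_measureReal_of_isPiSystem (P := gaussianPath)
      (ν := gaussianPath D • gaussianPath)
      (μ := fun n : ℕ => gaussianPath.restrict ((fun ω i => ω (i + n)) ⁻¹' D))
      (fun n => Measure.restrict_le_self) hgen hpi ?_ ?_ hB
    · simpa [measureReal_restrict_apply hB, measureReal_ennreal_smul_apply, measureReal_def,
        mul_comm] using this
    · have h := fun n => htr n hDm
      simp only [measureReal_def] at h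
      simp [measureReal_def, h]
    · intro s hs
      have hsm : MeasurableSet s := MeasurableSet.of_mem_measurableCylinders hs
      refine tendsto_nhds_of_eventually_eq ?_
      filter_upwards [eventually_measure_inter_translate hs hD] with n hn
      rw [measureReal_restrict_apply hsm, hn, measureReal_ennreal_smul_apply, measureReal_def,
        measureReal_def, mul_comm]
  -- With a measurable `B` fixed, extend from cylinders `C` to measurable `C`.
  have hfin := Measure.smul_finite gaussianPath (measure_ne_top gaussianPath B)
  have := tendsto_measureReal_of_isPiSystem (P := gaussianPath)
    (ν := gaussianPath B • gaussianPath)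
    (μ := fun n : ℕ => (gaussianPath.restrict B).map fun ω i => ω (i + n))
    (fun n => ?_) hgen hpi ?_ ?_ hC
  · simpa [measureReal_ennreal_smul_apply, measureReal_def, Measure.map_apply (hm _) hC,
      Measure.restrict_apply (hm _ hC), Set.inter_comm] using this
  · exact (Measure.map_mono Measure.restrict_le_self (hm n)).trans_eq
      (measurePreserving_translate n).map_eq
  · simp [measureReal_def, Measure.map_apply (hm _)]
  · intro s hs
    have hsm : MeasurableSet s := MeasurableSet.of_mem_measurableCylinders hs
    simpa [measureReal_ennreal_smul_apply, measureReal_def, Measure.map_apply (hm _) hsm,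
      Measure.restrict_apply (hm _ hsm), Set.inter_comm] using step s hs B hB

theorem ergodic_shift : Ergodic shift gaussianPath where
  toMeasurePreserving := measurePreserving_shift
  aeconst_set := by
    intro s hs hinv
    have hinvn : ∀ n : ℕ, (fun (ω : ℤ → ℝ) (i : ℤ) => ω (i + n)) ⁻¹' s = s := by
      intro n
      induction n with
      | zero => simp
      | succ n ih =>
        nth_rewrite 2 [← hinv]
        nth_rewrite 2 [← ih]
        ext ω
        simp [shift, add_assoc]
    have hlim := tendsto_measure_inter_translate hs hs
    simp only [hinvn, Set.inter_self] at hlim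
    have hsq := tendsto_nhds_unique hlim tendsto_const_nhds
    rw [eventuallyConst_set']
    rcases eq_or_ne (gaussianPath.real s) 0 with h | h
    · left
      exact ae_eq_empty.2 ((measureReal_eq_zero_iff).1 h)
    · right
      have h1 : gaussianPath.real s = 1 := mul_left_cancel₀ h (by rw [hsq, mul_one])
      rw [measureReal_def, ENNReal.toReal_eq_one_iff] at h1
      exact eventuallyEq_univ.2 (mem_ae_iff.2 ((prob_compl_eq_zero_iff hs).2 h1))

/-! ### Linear processes over Gaussian innovations -/

theorem memLp_coord (i : ℤ) : MemLp (fun ω : ℤ → ℝ => ω i) 2 gaussianPath := by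
  have h : MemLp id 2 (gaussianPath.map fun ω => ω i) := by
    rw [map_coord]; exact memLp_id_gaussianReal 2
  exact h.comp_of_map (measurable_pi_apply i).aemeasurable

theorem integral_coord (i : ℤ) : ∫ ω, ω i ∂gaussianPath = 0 := by
  have := integral_map (μ := gaussianPath) (measurable_pi_apply i).aemeasurable
    (f := fun x : ℝ => x) (by fun_prop)
  rw [← this, map_coord, integral_id_gaussianReal]

theorem integral_coord_mul_coord (i j : ℤ) :
    ∫ ω, ω i * ω j ∂gaussianPath = if i = j then 1 else 0 := by
  split_ifs with h
  · subst h
    have h1 := integral_map (μ := gaussianPath) (measurable_pi_apply i).aemeasurable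
      (f := fun x : ℝ => x * x) (by fun_prop)
    rw [← h1, map_coord]
    have h2 := variance_eq_integral (μ := gaussianReal 0 1) (X := id) (by fun_prop)
    rw [variance_id_gaussianReal] at h2
    simpa [integral_id_gaussianReal, sq] using h2.symm
  · have := (iIndepFun_coord.indepFun h).integral_fun_mul_eq_mul_integral
      (memLp_coord i).1 (memLp_coord j).1
    rw [this, integral_coord, zero_mul]

theorem eLpNorm_coord (i : ℤ) : eLpNorm (fun ω : ℤ → ℝ => ω i) 2 gaussianPath = 1 := by
  have h := (memLp_coord i).eLpNorm_eq_integral_rpow_norm (by norm_num) (by norm_num)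
  have h1 := integral_coord_mul_coord i i
  simp only [if_true] at h1
  rw [h]
  simp [← sq] at h1 ⊢
  simp [h1]

/-- The value `∑ m, c m * ω (k - m)` at time `k` of the causal linear process with
coefficients `c`. It is defined for every `ω`, by the value `0` where the series diverges. -/
noncomputable def causalSeries (c : ℕ → ℝ) (k : ℤ) (ω : ℤ → ℝ) : ℝ :=
  ∑' m : ℕ, c m * ω (k - m)

theorem process_causalSeries (c : ℕ → ℝ) (k : ℤ) :
    process shift (causalSeries c 0) k = causalSeries c k := by
  funext ω
  rw [process_shift]
  simp only [causalSeries]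
  congr 1
  funext m
  ring_nf

theorem measurable_causalSeries_coordSigma {c : ℕ → ℝ} {k : ℤ} {S : Set ℤ}
    (h : ∀ m : ℕ, c m ≠ 0 → k - m ∈ S) : Measurable[coordSigma S] (causalSeries c k) := by
  refine @Measurable.tsum _ _ _ (coordSigma S) _ _ _ _ _ _ _ _ _ _ _ _ fun m => ?_
  by_cases hm : c m = 0
  · simp only [hm, zero_mul]
    exact @measurable_const _ _ _ (coordSigma S) _
  · exact (measurable_coord (h m hm)).const_mul (c m)

theorem measurable_causalSeries (c : ℕ → ℝ) (k : ℤ) : Measurable (causalSeries c k) := by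
  unfold causalSeries; fun_prop

theorem eLpNorm_mul_coord (r : ℝ) (i : ℤ) :
    eLpNorm (fun ω : ℤ → ℝ => r * ω i) 2 gaussianPath = ENNReal.ofReal |r| := by
  have := eLpNorm_const_smul (μ := gaussianPath) (p := 2) r (fun ω : ℤ → ℝ => ω i)
  rw [eLpNorm_coord, mul_one, Real.enorm_eq_ofReal_abs] at this
  exact this

theorem ae_summable_causalSeries {c : ℕ → ℝ} (hc : Summable fun m => |c m|) (k : ℤ) :
    ∀ᵐ ω ∂gaussianPath, Summable fun m : ℕ => c m * ω (k - m) := by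
  have h := summable_norm_of_tsum_eLpNorm_ne_top (μ := gaussianPath) (p := 2)
    (f := fun (m : ℕ) (ω : ℤ → ℝ) => c m * ω (k - m)) (by norm_num)
    (fun m => (by fun_prop : Measurable _).aestronglyMeasurable) ?_
  · filter_upwards [h] with ω hω using hω.of_norm
  · simp only [eLpNorm_mul_coord]
    exact hc.tsum_ofReal_ne_top

theorem eLpNorm_causalSeries_le {c : ℕ → ℝ} (hc : Summable fun m => |c m|) (k : ℤ) :
    eLpNorm (causalSeries c k) 2 gaussianPath ≤ ENNReal.ofReal (∑' m, |c m|) := by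
  refine (Lp.eLpNorm_lim_le_liminf_eLpNorm
    (f := fun (N : ℕ) (ω : ℤ → ℝ) => ∑ m ∈ Finset.range N, c m * ω (k - m))
    (fun N => (by fun_prop : Measurable _).aestronglyMeasurable) _ ?_).trans ?_
  · filter_upwards [ae_summable_causalSeries hc k] with ω hω
    exact hω.hasSum.tendsto_sum_nat
  · refine liminf_le_of_le (by isBoundedDefault) fun b hb => ?_
    obtain ⟨N, hN⟩ := hb.exists
    refine hN.trans ?_
    have h1 := eLpNorm_sum_le (μ := gaussianPath) (p := 2) (s := Finset.range N)
      (f := fun (m : ℕ) (ω : ℤ → ℝ) => c m * ω (k - m))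
      (fun m _ => (by fun_prop : Measurable _).aestronglyMeasurable) (by norm_num)
    simp only [eLpNorm_mul_coord] at h1
    rw [← ENNReal.ofReal_sum_of_nonneg fun _ _ => abs_nonneg _, Finset.sum_fn] at h1
    exact h1.trans (ENNReal.ofReal_le_ofReal (hc.sum_le_tsum _ fun _ _ => abs_nonneg _))

theorem memLp_causalSeries {c : ℕ → ℝ} (hc : Summable fun m => |c m|) (k : ℤ) :
    MemLp (causalSeries c k) 2 gaussianPath :=
  ⟨(measurable_causalSeries c k).aestronglyMeasurable,
    (eLpNorm_causalSeries_le hc k).trans_lt ENNReal.ofReal_lt_top⟩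

theorem summable_abs_nat_add {c : ℕ → ℝ} (hc : Summable fun m => |c m|) (r : ℕ) :
    Summable fun m => |c (m + r)| :=
  (summable_nat_add_iff r).2 hc

theorem causalSeries_eq_sum_add {c : ℕ → ℝ} {k : ℤ} {ω : ℤ → ℝ}
    (h : Summable fun m : ℕ => c m * ω (k - m)) (r : ℕ) :
    causalSeries c k ω = ∑ m ∈ Finset.range r, c m * ω (k - m)
      + causalSeries (fun m => c (m + r)) (k - r) ω := by
  unfold causalSeries
  rw [← h.sum_add_tsum_nat_add r]
  congr 2
  funext m
  push_cast
  ring_nf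

/-- The partial sums of the series converge in `L²`, at the rate of the tails of `∑ |c m|`. -/
theorem tendsto_eLpNorm_causalSeries_sub {c : ℕ → ℝ} (hc : Summable fun m => |c m|) (k : ℤ) :
    Tendsto (fun N : ℕ => eLpNorm
      (fun ω => causalSeries c k ω - ∑ m ∈ Finset.range N, c m * ω (k - m)) 2 gaussianPath)
      atTop (𝓝 0) := by
  have htail : Tendsto (fun N : ℕ => ENNReal.ofReal (∑' m, |c (m + N)|)) atTop (𝓝 0) := by
    simpa using ENNReal.tendsto_ofReal (tendsto_sum_nat_add fun m => |c m|)
  refine tendsto_of_tendsto_of_tendsto_of_le_of_le tendsto_const_nhds htail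
    (fun _ => zero_le) fun N => ?_
  refine (le_of_eq (eLpNorm_congr_ae ?_)).trans
    (eLpNorm_causalSeries_le (summable_abs_nat_add hc N) (k - N))
  filter_upwards [ae_summable_causalSeries hc k] with ω hω
  rw [causalSeries_eq_sum_add hω N, add_sub_cancel_left]

/-- Conditioning on the coordinates up to time `k - r` erases the first `r` terms of the
series. -/
theorem condExp_causalSeries {c : ℕ → ℝ} (hc : Summable fun m => |c m|) (k : ℤ) (r : ℕ) :
    gaussianPath[causalSeries c k | coordSigma (Set.Iic (k - r))]
      =ᵐ[gaussianPath] causalSeries (fun m => c (m + r)) (k - r) := by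
  set F := coordSigma (Set.Iic (k - r))
  have hF : F ≤ MeasurableSpace.pi := coordSigma_le _
  set U : (ℤ → ℝ) → ℝ := fun ω => ∑ m ∈ Finset.range r, c m * ω (k - m)
  set V := causalSeries (fun m => c (m + r)) (k - r)
  have hUm : Measurable[coordSigma (Set.Ioi (k - r))] U := by
    refine Finset.measurable_sum (m := coordSigma (Set.Ioi (k - r))) _ fun m hm => ?_
    refine (measurable_coord ?_).const_mul (c m)
    have := Finset.mem_range.1 hm
    simp only [Set.mem_Ioi]
    omega
  have hVm : Measurable[F] V := measurable_causalSeries_coordSigma fun m _ => by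
    simp only [Set.mem_Iic]
    omega
  have hUi : Integrable U gaussianPath := integrable_finsetSum _ fun m _ =>
    ((memLp_coord _).integrable (by norm_num)).const_mul _
  have hVi : Integrable V gaussianPath :=
    (memLp_causalSeries (summable_abs_nat_add hc r) _).integrable (by norm_num)
  have hsum : causalSeries c k =ᵐ[gaussianPath] U + V := by
    filter_upwards [ae_summable_causalSeries hc k] with ω hω
    exact causalSeries_eq_sum_add hω r
  have hU0 : ∫ ω, U ω ∂gaussianPath = 0 := by
    rw [integral_finsetSum _ fun m _ => ((memLp_coord _).integrable (by norm_num)).const_mul _]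
    simp [integral_const_mul, integral_coord]
  have hUc : gaussianPath[U | F] =ᵐ[gaussianPath] fun _ => 0 := by
    have := condExp_indep_eq (m₁ := coordSigma (Set.Ioi (k - r))) (m₂ := F) (coordSigma_le _) hF
      hUm.stronglyMeasurable (indep_coordSigma (by
        rw [Set.disjoint_left]
        intro x hx hx'
        exact (Set.mem_Ioi.1 hx).not_ge (Set.mem_Iic.1 hx')))
    rwa [hU0] at this
  filter_upwards [condExp_congr_ae (m := F) hsum, condExp_add hUi hVi F, hUc] with ω h1 h2 h3
  rw [h1, h2, Pi.add_apply, h3, zero_add, condExp_of_stronglyMeasurable hF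
    hVm.stronglyMeasurable hVi]

theorem isRegularProcess_causalSeries {c : ℕ → ℝ} (hc : Summable fun m => |c m|) :
    IsRegularProcess (coordSigma (Set.Iic 0)) gaussianPath shift (causalSeries c 0) := by
  have hlim : Tendsto (fun k : ℕ => (∑' m, |c (m + k)|) ^ 2) atTop (𝓝 0) := by
    simpa using (tendsto_sum_nat_add fun m => |c m|).pow 2
  refine squeeze_zero (fun k => integral_nonneg fun ω => by positivity) (fun k => ?_) hlim
  have hce : gaussianPath[causalSeries c 0 | sigmaAt (coordSigma (Set.Iic 0)) shift (-(k : ℤ))]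
      =ᵐ[gaussianPath] causalSeries (fun m => c (m + k)) (0 - k) := by
    rw [sigmaAt_coordSigma]
    simpa only [zero_sub] using condExp_causalSeries hc 0 k
  have hm := memLp_causalSeries (summable_abs_nat_add hc k) (0 - k)
  have hle := eLpNorm_causalSeries_le (summable_abs_nat_add hc k) (0 - k)
  rw [hm.eLpNorm_eq_integral_rpow_norm (by norm_num) (by norm_num),
    ENNReal.ofReal_le_ofReal_iff (tsum_nonneg fun _ => abs_nonneg _)] at hle
  have heq : ∫ ω, |(gaussianPath[causalSeries c 0 |
      sigmaAt (coordSigma (Set.Iic 0)) shift (-(k : ℤ))]) ω| ^ 2 ∂gaussianPath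
      = ∫ ω, ‖causalSeries (fun m => c (m + k)) (0 - k) ω‖ ^ (2 : ENNReal).toReal
        ∂gaussianPath := by
    refine integral_congr_ae ?_
    filter_upwards [hce] with ω hω
    rw [hω]
    simp
  rw [heq]
  have h0 : 0 ≤ ∫ ω, ‖causalSeries (fun m => c (m + k)) (0 - k) ω‖ ^ (2 : ENNReal).toReal
        ∂gaussianPath := integral_nonneg fun ω => by positivity
  have h2 := pow_le_pow_left₀ (Real.rpow_nonneg h0 _) hle 2
  rw [← Real.rpow_mul_natCast h0] at h2
  simpa using h2

/-! ### The spectral density of a linear process -/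

theorem integral_causalSeries {c : ℕ → ℝ} (hc : Summable fun m => |c m|) (k : ℤ) :
    ∫ ω, causalSeries c k ω ∂gaussianPath = 0 := by
  have hint : ∀ m : ℕ, Integrable (fun ω : ℤ → ℝ => c m * ω (k - m)) gaussianPath := fun m =>
    ((memLp_coord _).integrable (by norm_num)).const_mul _
  have hs : Summable fun m : ℕ => ∫ ω : ℤ → ℝ, ‖c m * ω (k - m)‖ ∂gaussianPath := by
    refine hc.of_nonneg_of_le (fun m => integral_nonneg fun _ => norm_nonneg _) fun m => ?_
    have h1 := eLpNorm_le_eLpNorm_of_exponent_le (μ := gaussianPath) (p := 1) (q := 2)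
      (by norm_num) (hint m).1
    rw [eLpNorm_mul_coord, (memLp_one_iff_integrable.2 (hint m)).eLpNorm_eq_integral_rpow_norm
      (by norm_num) (by norm_num), ENNReal.ofReal_le_ofReal_iff (abs_nonneg _)] at h1
    simpa using h1
  have := hasSum_integral_of_summable_integral_norm hint hs
  rw [show ∫ ω, causalSeries c k ω ∂gaussianPath
    = ∫ ω : ℤ → ℝ, ∑' m : ℕ, c m * ω (k - m) ∂gaussianPath from rfl, ← this.tsum_eq]
  simp [integral_const_mul, integral_coord]

theorem summable_abs_mul_abs {c : ℕ → ℝ} (hc : Summable fun m => |c m|) :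
    Summable fun x : ℕ × ℕ => |c x.1| * |c x.2| :=
  hc.mul_of_nonneg hc (fun _ => abs_nonneg _) fun _ => abs_nonneg _

/-- The covariances in the form in which they are also obtained by integrating the product
expansion of the squared transfer function term by term. -/
theorem covariance_causalSeries {c : ℕ → ℝ} (hc : Summable fun m => |c m|) (k : ℤ) :
    cov[causalSeries c 0, causalSeries c k; gaussianPath]
      = ∑' x : ℕ × ℕ, c x.1 * c x.2 * if (x.1 : ℤ) - x.2 + k = 0 then 1 else 0 := by
  rw [covariance_eq_sub (memLp_causalSeries hc 0) (memLp_causalSeries hc k),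
    integral_causalSeries hc, zero_mul, sub_zero]
  have hint : ∀ x : ℕ × ℕ, Integrable (fun ω : ℤ → ℝ =>
      c x.1 * ω (0 - x.1) * (c x.2 * ω (k - x.2))) gaussianPath := fun x =>
    ((memLp_coord _).const_mul _).integrable_mul ((memLp_coord _).const_mul _)
  have hs : Summable fun x : ℕ × ℕ => ∫ ω : ℤ → ℝ,
      ‖c x.1 * ω (0 - x.1) * (c x.2 * ω (k - x.2))‖ ∂gaussianPath := by
    refine (summable_abs_mul_abs hc).of_nonneg_of_le
      (fun m => integral_nonneg fun _ => norm_nonneg _) fun x => ?_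
    have hsq : ∀ i : ℤ, Integrable (fun ω : ℤ → ℝ => ω i * ω i) gaussianPath := fun i =>
      (memLp_coord i).integrable_mul (memLp_coord i)
    have : ∫ ω : ℤ → ℝ, ‖c x.1 * ω (0 - x.1) * (c x.2 * ω (k - x.2))‖ ∂gaussianPath
        ≤ ∫ ω : ℤ → ℝ, |c x.1| * |c x.2| * ((ω (0 - x.1) * ω (0 - x.1)
          + ω (k - x.2) * ω (k - x.2)) / 2) ∂gaussianPath := by
      refine integral_mono (hint x).norm ((((hsq _).add (hsq _)).div_const _).const_mul _)
        fun ω => ?_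
      simp only [Real.norm_eq_abs, abs_mul]
      have h1 : |ω (0 - x.1)| * |ω (k - x.2)| ≤ (ω (0 - x.1) * ω (0 - x.1)
          + ω (k - x.2) * ω (k - x.2)) / 2 := by
        rw [← abs_mul_abs_self (ω (0 - x.1)), ← abs_mul_abs_self (ω (k - x.2))]
        nlinarith [sq_nonneg (|ω (0 - x.1)| - |ω (k - x.2)|)]
      calc _ = |c x.1| * |c x.2| * (|ω (0 - x.1)| * |ω (k - x.2)|) := by ring
        _ ≤ _ := by gcongr
    refine this.trans_eq ?_
    rw [integral_const_mul, integral_div, integral_add (hsq _) (hsq _),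
      integral_coord_mul_coord, integral_coord_mul_coord]
    simp
  have hsum := hasSum_integral_of_summable_integral_norm hint hs
  have hprod : ∫ ω, (causalSeries c 0 * causalSeries c k) ω ∂gaussianPath = ∫ ω : ℤ → ℝ,
      ∑' x : ℕ × ℕ, c x.1 * ω (0 - x.1) * (c x.2 * ω (k - x.2)) ∂gaussianPath := by
    refine integral_congr_ae ?_
    filter_upwards [ae_summable_causalSeries hc 0, ae_summable_causalSeries hc k] with ω h0 hk
    exact tsum_mul_tsum_of_summable_norm h0.norm hk.norm
  rw [hprod, ← hsum.tsum_eq]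
  congr 1
  funext x
  have : ∀ ω : ℤ → ℝ, c x.1 * ω (0 - x.1) * (c x.2 * ω (k - x.2))
      = c x.1 * c x.2 * (ω (0 - x.1) * ω (k - x.2)) := fun ω => by ring
  simp only [this, integral_const_mul, integral_coord_mul_coord]
  congr 2
  exact propext ⟨fun h => by omega, fun h => by omega⟩

theorem integral_exp_int (n : ℤ) :
    ∫ θ in Set.Ico 0 (2 * Real.pi), Complex.exp (Complex.I * (n : ℂ) * (θ : ℂ))
      = if n = 0 then 2 * (Real.pi : ℂ) else 0 := by
  rw [integral_Ico_eq_integral_Ioc, ← intervalIntegral.integral_of_le (by positivity)]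
  split_ifs with h
  · subst h; simp
  · have hn : Complex.I * (n : ℂ) ≠ 0 := by simp [h]
    rw [integral_exp_mul_complex hn]
    have : Complex.exp (Complex.I * n * ((2 * Real.pi : ℝ) : ℂ)) = 1 := by
      rw [← Complex.exp_int_mul_two_pi_mul_I n]
      congr 1
      push_cast
      ring
    rw [this]
    simp

/-- The transfer function `θ ↦ ∑ m, c m * exp (i m θ)` of the coefficients `c`. -/
noncomputable def transferFunction (c : ℕ → ℝ) (θ : ℝ) : ℂ :=
  ∑' m : ℕ, (c m : ℂ) * Complex.exp (Complex.I * (m : ℂ) * (θ : ℂ))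

theorem norm_exp_I_mul (n : ℤ) (θ : ℝ) :
    ‖Complex.exp (Complex.I * (n : ℂ) * (θ : ℂ))‖ = 1 := by
  rw [show Complex.I * (n : ℂ) * (θ : ℂ) = ((n * θ : ℝ) : ℂ) * Complex.I by push_cast; ring]
  exact Complex.norm_exp_ofReal_mul_I _

theorem norm_exp_I_mul_nat (n : ℕ) (θ : ℝ) :
    ‖Complex.exp (Complex.I * (n : ℂ) * (θ : ℂ))‖ = 1 := by
  simpa using norm_exp_I_mul n θ

theorem summable_norm_transferFunction {c : ℕ → ℝ} (hc : Summable fun m => |c m|) (θ : ℝ) :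
    Summable fun m : ℕ => ‖(c m : ℂ) * Complex.exp (Complex.I * (m : ℂ) * (θ : ℂ))‖ := by
  simpa [norm_exp_I_mul_nat] using hc

theorem normSq_transferFunction_mul_exp {c : ℕ → ℝ} (hc : Summable fun m => |c m|) (k : ℤ)
    (θ : ℝ) :
    ((‖transferFunction c θ‖ ^ 2 : ℝ) : ℂ) * Complex.exp (Complex.I * (k : ℂ) * (θ : ℂ))
      = ∑' x : ℕ × ℕ, ((c x.1 * c x.2 : ℝ) : ℂ) *
        Complex.exp (Complex.I * (((x.1 : ℤ) - x.2 + k : ℤ) : ℂ) * (θ : ℂ)) := by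
  have hs := summable_norm_transferFunction hc θ
  have hs' : Summable fun m : ℕ => ‖starRingEnd ℂ
      ((c m : ℂ) * Complex.exp (Complex.I * (m : ℂ) * (θ : ℂ)))‖ := by
    simpa only [RCLike.norm_conj] using hs
  rw [Complex.ofReal_pow, ← Complex.mul_conj']
  unfold transferFunction
  rw [Complex.conj_tsum, tsum_mul_tsum_of_summable_norm hs hs', ← tsum_mul_right]
  congr 1
  funext x
  rw [map_mul, ← Complex.exp_conj]
  simp only [map_mul, Complex.conj_I, Complex.conj_ofReal, Complex.conj_natCast]
  have : Complex.I * (((x.1 : ℤ) - x.2 + k : ℤ) : ℂ) * (θ : ℂ)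
      = Complex.I * (x.1 : ℂ) * θ + -Complex.I * (x.2 : ℂ) * θ + Complex.I * (k : ℂ) * θ := by
    push_cast; ring
  rw [this, Complex.exp_add, Complex.exp_add]
  push_cast
  ring

theorem continuous_transferFunction {c : ℕ → ℝ} (hc : Summable fun m => |c m|) :
    Continuous (transferFunction c) := by
  refine continuous_tsum (fun m => by fun_prop) hc fun m θ => ?_
  simp [norm_exp_I_mul_nat]

theorem isSpectralDensity_causalSeries {c : ℕ → ℝ} (hc : Summable fun m => |c m|) :
    IsSpectralDensity gaussianPath (process shift (causalSeries c 0))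
      fun θ => ‖transferFunction c θ‖ ^ 2 where
  nonneg θ := by positivity
  integrableOn := (((continuous_transferFunction hc).norm.pow 2).integrableOn_Icc).mono_set
    Set.Ico_subset_Icc_self
  fourier k := by
    rw [process_causalSeries, process_causalSeries, covariance_causalSeries hc]
    simp only [normSq_transferFunction_mul_exp hc]
    have hint : ∀ x : ℕ × ℕ, Integrable (fun θ : ℝ => ((c x.1 * c x.2 : ℝ) : ℂ) *
        Complex.exp (Complex.I * (((x.1 : ℤ) - x.2 + k : ℤ) : ℂ) * (θ : ℂ)))
        (volume.restrict (Set.Ico 0 (2 * Real.pi))) := fun x =>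
      IntegrableOn.mono_set (Continuous.integrableOn_Icc (by fun_prop)) Set.Ico_subset_Icc_self
    have hs : Summable fun x : ℕ × ℕ => ∫ θ : ℝ in Set.Ico 0 (2 * Real.pi),
        ‖((c x.1 * c x.2 : ℝ) : ℂ) *
          Complex.exp (Complex.I * (((x.1 : ℤ) - x.2 + k : ℤ) : ℂ) * (θ : ℂ))‖ := by
      simp only [norm_mul, norm_exp_I_mul, Complex.norm_real, mul_one, Real.norm_eq_abs]
      simp only [integral_const, smul_eq_mul]
      exact (summable_abs_mul_abs hc).mul_left _
    rw [← (hasSum_integral_of_summable_integral_norm hint hs).tsum_eq, ← tsum_mul_left,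
      Complex.ofReal_tsum]
    congr 1
    funext x
    rw [integral_const_mul, integral_exp_int]
    have : (Real.pi : ℂ) ≠ 0 := by exact_mod_cast Real.pi_ne_zero
    split_ifs
    · push_cast; field_simp
    · simp

/-! ### Gaussian blocks -/

theorem map_sum_coord (I : Finset ℕ) (u : ℕ → ℝ) {g : ℕ → ℤ} (hg : Function.Injective g) :
    gaussianPath.map (fun ω => ∑ k ∈ I, u k * ω (g k))
      = gaussianReal 0 (∑ k ∈ I, Real.toNNReal (u k ^ 2)) := by
  induction I using Finset.induction_on with
  | empty => simp [gaussianReal_zero_var]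
  | insert i I hi ih =>
    have hmI : Measurable[coordSigma (g '' I)] fun ω : ℤ → ℝ => ∑ k ∈ I, u k * ω (g k) :=
      Finset.measurable_sum (m := coordSigma (g '' I)) _ fun k hk =>
        (measurable_coord (Set.mem_image_of_mem g hk)).const_mul (u k)
    have hmi : Measurable[coordSigma {g i}] fun ω : ℤ → ℝ => u i * ω (g i) :=
      (measurable_coord (Set.mem_singleton _)).const_mul (u i)
    have hind : IndepFun (fun ω : ℤ → ℝ => u i * ω (g i)) (fun ω => ∑ k ∈ I, u k * ω (g k))
        gaussianPath := by
      refine indep_of_indep_of_le_left (indep_of_indep_of_le_right (indep_coordSigma ?_)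
        hmI.comap_le) hmi.comap_le
      rw [Set.disjoint_singleton_left]
      rintro ⟨k, hk, hki⟩
      exact hi (hg hki ▸ hk)
    have hlaw : gaussianPath.map (fun ω => u i * ω (g i))
        = gaussianReal 0 (Real.toNNReal (u i ^ 2)) := by
      have h1 := gaussianReal_map_const_mul (μ := 0) (v := 1) (u i)
      rw [← map_coord (g i), Measure.map_map (by fun_prop) (by fun_prop)] at h1
      rw [mul_zero, mul_one] at h1
      rw [Real.toNNReal_of_nonneg (sq_nonneg _)]
      exact h1
    have hmeq : (fun ω : ℤ → ℝ => ∑ k ∈ insert i I, u k * ω (g k))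
        = (fun ω => u i * ω (g i)) + fun ω => ∑ k ∈ I, u k * ω (g k) := by
      funext ω
      simp [Finset.sum_insert hi]
    rw [hmeq, gaussianReal_add_gaussianReal_of_indepFun hind hlaw ih, Finset.sum_insert hi,
      add_zero]

/-- The standard Gaussian tail `P (Z ≥ x)`. -/
noncomputable def gaussianTail (x : ℝ) : ℝ := (gaussianReal 0 1).real (Set.Ici x)

theorem gaussianTail_pos (x : ℝ) : 0 < gaussianTail x := by
  refine ENNReal.toReal_pos (fun h => ?_) (measure_ne_top _ _)
  have := gaussianReal_absolutelyContinuous' 0 (one_ne_zero : (1 : NNReal) ≠ 0) h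
  simp at this

theorem gaussianTail_le_one (x : ℝ) : gaussianTail x ≤ 1 := measureReal_le_one

theorem gaussianTail_le_gaussianReal_Ici {v : NNReal} {s t : ℝ} (hs : 0 < s) (ht : 0 ≤ t)
    (hv : s ^ 2 ≤ v) : gaussianTail (t / s) ≤ (gaussianReal 0 v).real (Set.Ici t) := by
  have h1 := gaussianReal_map_const_mul (μ := 0) (v := 1) (Real.sqrt v)
  have hvar : NNReal.mk (Real.sqrt v ^ 2) (sq_nonneg _) * 1 = v := by
    rw [mul_one]
    exact NNReal.eq (Real.sq_sqrt v.2)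
  rw [mul_zero, hvar] at h1
  rw [← h1, measureReal_def, Measure.map_apply (by fun_prop) measurableSet_Ici]
  refine measureReal_mono fun z hz => ?_
  have hz' : t / s ≤ z := hz
  have hz0 : 0 ≤ z := (by positivity : 0 ≤ t / s).trans hz'
  have hsv : s ≤ Real.sqrt v := Real.le_sqrt_of_sq_le hv
  calc t = s * (t / s) := by field_simp
    _ ≤ Real.sqrt v * z := by gcongr

/-- Adding a constant to a centered Gaussian variable does not make it substantially smaller:
the half-line on the side of the constant is enough. -/
theorem gaussianReal_abs_add_lt_le {v : NNReal} {s t : ℝ} (hs : 0 < s) (ht : 0 ≤ t)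
    (hv : s ^ 2 ≤ v) (r : ℝ) :
    (gaussianReal 0 v).real {x | |x + r| < t} ≤ 1 - gaussianTail (t / s) := by
  have hm : MeasurableSet {x : ℝ | |x + r| < t} :=
    measurableSet_lt (by fun_prop) measurable_const
  have hcompl := probReal_compl_eq_one_sub (μ := gaussianReal 0 v) hm
  have hkey : gaussianTail (t / s) ≤ (gaussianReal 0 v).real {x | |x + r| < t}ᶜ := by
    have hIci := gaussianTail_le_gaussianReal_Ici hs ht hv
    rcases le_total 0 r with hr | hr
    · refine hIci.trans (measureReal_mono fun x hx => ?_)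
      simp only [Set.mem_compl_iff, Set.mem_ofPred_eq, not_lt]
      have : t ≤ x := hx
      exact (by linarith : t ≤ x + r).trans (le_abs_self _)
    · have hneg := gaussianReal_map_neg (μ := 0) (v := v)
      rw [neg_zero] at hneg
      rw [← hneg, measureReal_def, Measure.map_apply (by fun_prop) hm.compl]
      refine hIci.trans (measureReal_mono fun x hx => ?_)
      simp only [Set.mem_preimage, Set.mem_compl_iff, Set.mem_ofPred_eq, not_lt]
      have : t ≤ x := hx
      exact (by linarith : t ≤ -(-x + r)).trans (neg_le_abs _)
  linarith

/-! ### Repeated independent trials -/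

/-- If the noise `V` is independent of the event `A` and of the perturbation `R`, and every
constant perturbation leaves `|V + r| < t` with probability at most `p`, then `|V + R| < t` has
conditional probability at most `p` given `A`. -/
theorem measure_inter_abs_add_lt_le {Ω : Type*} {m₁ m₂ : MeasurableSpace Ω}
    [mΩ : MeasurableSpace Ω] {P : Measure Ω} [IsProbabilityMeasure P] (h₁ : m₁ ≤ mΩ) (h₂ : m₂ ≤ mΩ)
    (hind : Indep m₁ m₂ P) {V R : Ω → ℝ} (hV : Measurable[m₁] V) (hR : Measurable[m₂] R)
    {A : Set Ω} (hA : MeasurableSet[m₂] A) {t : ℝ} {p : ENNReal}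
    (hp : ∀ r, P {ω | |V ω + r| < t} ≤ p) :
    P (A ∩ {ω | |V ω + R ω| < t}) ≤ p * P A := by
  -- The event `A` enters through its indicator, as a second coordinate next to `R`.
  set W : Ω → ℝ × ℝ := fun ω => (R ω, A.indicator (fun _ => 1) ω)
  have hind₂ : Measurable[m₂] (A.indicator fun _ => (1 : ℝ)) :=
    (measurable_const (α := ℝ)).indicator hA
  have hWm₂ : Measurable[m₂] W := hR.prodMk hind₂
  have hWm : Measurable W := hWm₂.mono h₂ le_rfl
  have hVm : Measurable V := hV.mono h₁ le_rfl
  have hWV : IndepFun W V P :=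
    indep_of_indep_of_le_left (indep_of_indep_of_le_right hind.symm hV.comap_le) hWm₂.comap_le
  have hprod := (indepFun_iff_map_prod_eq_prod_map_map hWm.aemeasurable hVm.aemeasurable).1 hWV
  set E : Set ((ℝ × ℝ) × ℝ) := {z | z.1.2 = 1 ∧ |z.2 + z.1.1| < t}
  have hE : MeasurableSet E :=
    (measurableSet_eq_fun (f := fun z : (ℝ × ℝ) × ℝ => z.1.2) (by fun_prop)
      measurable_const).inter (measurableSet_lt (f := fun z : (ℝ × ℝ) × ℝ => |z.2 + z.1.1|)
        (by fun_prop) measurable_const)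
  have hset : A ∩ {ω | |V ω + R ω| < t} = (fun ω => (W ω, V ω)) ⁻¹' E := by
    ext ω
    by_cases h : ω ∈ A <;> simp [E, W, h]
  have hF : MeasurableSet {z : ℝ × ℝ | z.2 = 1} :=
    measurableSet_eq_fun (by fun_prop) measurable_const
  have := Measure.isProbabilityMeasure_map (μ := P) hWm.aemeasurable
  have := Measure.isProbabilityMeasure_map (μ := P) hVm.aemeasurable
  rw [hset, ← Measure.map_apply (hWm.prodMk hVm) hE, hprod, Measure.prod_apply hE]
  calc ∫⁻ w, (P.map V) (Prod.mk w ⁻¹' E) ∂(P.map W)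
      ≤ ∫⁻ w, {z : ℝ × ℝ | z.2 = 1}.indicator (fun _ => p) w ∂(P.map W) := by
        refine lintegral_mono fun w => ?_
        rw [Measure.map_apply hVm (measurable_prodMk_left hE)]
        by_cases hw : w.2 = 1
        · simpa [E, hw] using hp w.1
        · simp [E, hw]
    _ = p * P A := by
        rw [lintegral_indicator_const hF, Measure.map_apply hWm hF]
        congr 2
        ext ω
        by_cases h : ω ∈ A <;> simp [W, h]

/-- The iterated form of `measure_inter_abs_add_lt_le`: the noises `V j` depend on disjoint sets
of coordinates, all disjoint from the set `T` on which the perturbations `R j` depend. The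
perturbations need not be independent of each other. -/
theorem measure_forall_abs_add_lt_le {J : ℕ} {S : ℕ → Set ℤ} {T : Set ℤ}
    (hS : ∀ i j, i ≠ j → Disjoint (S i) (S j)) (hT : ∀ j < J, Disjoint (S j) T)
    {V R : ℕ → (ℤ → ℝ) → ℝ} (hV : ∀ j, Measurable[coordSigma (S j)] (V j))
    (hR : ∀ j < J, Measurable[coordSigma T] (R j)) {t : ℕ → ℝ} {p : ENNReal}
    (hp : ∀ j r, gaussianPath {ω | |V j ω + r| < t j} ≤ p) :
    gaussianPath {ω | ∀ j < J, |V j ω + R j ω| < t j} ≤ p ^ J := by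
  suffices H : ∀ K ≤ J, gaussianPath {ω | ∀ j < K, |V j ω + R j ω| < t j} ≤ p ^ K from
    H J le_rfl
  intro K
  induction K with
  | zero => intro _; simp
  | succ K ih =>
    intro hK
    have hset : {ω : ℤ → ℝ | ∀ j < K + 1, |V j ω + R j ω| < t j}
        = {ω | ∀ j < K, |V j ω + R j ω| < t j} ∩ {ω | |V K ω + R K ω| < t K} := by
      ext ω
      exact Nat.forall_lt_succ_right
    have hTK : T ⊆ (S K)ᶜ := fun x hx hx' => Set.disjoint_left.1 (hT K hK) hx' hx
    have hA : MeasurableSet[coordSigma (S K)ᶜ] {ω | ∀ j < K, |V j ω + R j ω| < t j} := by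
      rw [show {ω : ℤ → ℝ | ∀ j < K, |V j ω + R j ω| < t j}
        = ⋂ j : Fin K, {ω | |V j ω + R j ω| < t j} by ext; simp [Fin.forall_iff]]
      refine @MeasurableSet.iInter _ _ (coordSigma (S K)ᶜ) _ _ fun j => ?_
      have hVj : Measurable[coordSigma (S K)ᶜ] (V j) :=
        (hV j).mono (coordSigma_mono fun x hx hx' =>
          Set.disjoint_left.1 (hS j K j.2.ne) hx hx') le_rfl
      have hRj : Measurable[coordSigma (S K)ᶜ] (R j) :=
        (hR j (by have := j.2; omega)).mono (coordSigma_mono hTK) le_rfl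
      have : Measurable[coordSigma (S K)ᶜ] fun ω => |V j ω + R j ω| :=
        measurable_norm.comp (hVj.add hRj)
      exact this measurableSet_Iio
    rw [hset]
    refine (measure_inter_abs_add_lt_le (coordSigma_le _) (coordSigma_le _)
      (indep_coordSigma disjoint_compl_right) (hV K) ((hR K hK).mono (coordSigma_mono hTK) le_rfl)
      hA (hp K)).trans ?_
    rw [pow_succ']
    gcongr
    exact ih (by omega)

/-! ### The past part of the Fourier transform -/

/-- The part of the discrete Fourier transform of a linear process that depends on the
coordinates with index `≤ 0`; it is a version of `E[S_n(θ) | F₀]`. -/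
noncomputable def pastDft (c : ℕ → ℝ) (n : ℕ) (θ : ℝ) (ω : ℤ → ℝ) : ℂ :=
  ∑ k ∈ Finset.range n, (causalSeries (fun m => c (m + k)) 0 ω : ℂ) *
    Complex.exp (Complex.I * (k : ℂ) * (θ : ℂ))

/-- The real or the imaginary part of `exp (i k θ)` carries at least half of the energy of a
dyadic block of indices `k`. -/
theorem exists_coordinate_sum_sq_ge (θ : ℝ) (j : ℕ) : ∃ φ : ℂ →L[ℝ] ℝ, (∀ z, |φ z| ≤ ‖z‖) ∧
    (2 : ℝ) ^ j / 2 ≤ ∑ k ∈ Finset.Ico (2 ^ j : ℕ) (2 ^ (j + 1)),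
      φ (Complex.exp (Complex.I * (k : ℂ) * (θ : ℂ))) ^ 2 := by
  set e : ℕ → ℂ := fun k => Complex.exp (Complex.I * (k : ℂ) * (θ : ℂ))
  have hsum : ∑ k ∈ Finset.Ico (2 ^ j) (2 ^ (j + 1)), (e k).re ^ 2
      + ∑ k ∈ Finset.Ico (2 ^ j) (2 ^ (j + 1)), (e k).im ^ 2 = (2 : ℝ) ^ j := by
    rw [← Finset.sum_add_distrib]
    have : ∀ k, (e k).re ^ 2 + (e k).im ^ 2 = 1 := fun k => by
      have h := Complex.sq_norm (e k)
      rw [norm_exp_I_mul_nat, Complex.normSq_apply] at h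
      linarith
    simp only [this, Finset.sum_const, Nat.card_Ico, nsmul_eq_mul, mul_one]
    rw [pow_succ, mul_two, Nat.add_sub_cancel]
    norm_num
  rcases le_total ((2 : ℝ) ^ j / 2) (∑ k ∈ Finset.Ico (2 ^ j) (2 ^ (j + 1)), (e k).re ^ 2)
    with h | h
  · exact ⟨Complex.reCLM, Complex.abs_re_le_norm, h⟩
  · refine ⟨Complex.imCLM, Complex.abs_im_le_norm, ?_⟩
    simp only [Complex.imCLM_apply]
    linarith

/-- Isolating the contribution of the single coefficient `a n₀`. -/
theorem causalSeries_eq_add_update {a : ℕ → ℝ} (ha : Summable fun m => |a m|) {n₀ k : ℕ}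
    (hk : k ≤ n₀) :
    ∀ᵐ ω ∂gaussianPath, causalSeries (fun m => a (m + k)) 0 ω
      = a n₀ * ω (k - n₀) + causalSeries (fun m => Function.update a n₀ 0 (m + k)) 0 ω := by
  filter_upwards [ae_summable_causalSeries (summable_abs_nat_add ha k) 0] with ω hω
  unfold causalSeries
  rw [hω.tsum_eq_add_tsum_ite (n₀ - k)]
  congr 1
  · rw [Nat.sub_add_cancel hk, Nat.cast_sub hk]
    ring_nf
  · congr 1
    funext m
    by_cases hm : m = n₀ - k
    · have : m + k = n₀ := by omega
      simp [hm, Nat.sub_add_cancel hk]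
    · have : m + k ≠ n₀ := by omega
      simp [hm, this]

/-- An isolated coefficient `a n₀`, with no other non-zero coefficient at distance less than
`2 ^ J`, gives `J` independent trials for `‖pastDft a n θ‖` to exceed `K √n`: the increments
of `pastDft a · θ` over the dyadic blocks `[2 ^ j, 2 ^ (j + 1))`. -/
theorem measure_forall_pastDft_lt_le {a : ℕ → ℝ} (ha : Summable fun m => |a m|) {n₀ J : ℕ}
    (hJ : 2 ^ J ≤ n₀) (hiso : ∀ i, i ≠ n₀ → i < n₀ + 2 ^ J → n₀ < i + 2 ^ J → a i = 0)
    (hb : 0 < a n₀) {K : ℝ} (hK : 0 ≤ K) (θ : ℝ) :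
    gaussianPath {ω | ∀ n : ℕ, 1 ≤ n → n ≤ 2 ^ J → ‖pastDft a n θ ω‖ < K * Real.sqrt n}
      ≤ ENNReal.ofReal (1 - gaussianTail (3 * K * Real.sqrt 2 / a n₀)) ^ J := by
  set e : ℕ → ℂ := fun k => Complex.exp (Complex.I * (k : ℂ) * (θ : ℂ))
  choose φ hφ hφsum using exists_coordinate_sum_sq_ge θ
  -- `V j` is the contribution of `a n₀` to the `j`-th block; it involves the coordinates in `S j`,
  -- and the remaining contributions `R j` involve only those in `T`.
  set B : ℕ → Finset ℕ := fun j => Finset.Ico (2 ^ j) (2 ^ (j + 1))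
  set S : ℕ → Set ℤ := fun j => (fun k : ℕ => (k : ℤ) - n₀) '' (B j : Set ℕ)
  set T : Set ℤ := {i | i + n₀ < 1 ∨ (2 : ℤ) ^ J ≤ i + n₀}
  set V : ℕ → (ℤ → ℝ) → ℝ := fun j ω => ∑ k ∈ B j, φ j (e k) * a n₀ * ω ((k : ℤ) - n₀)
  set R : ℕ → (ℤ → ℝ) → ℝ := fun j ω => ∑ k ∈ B j,
    φ j (e k) * causalSeries (fun m => Function.update a n₀ 0 (m + k)) 0 ω
  set t : ℕ → ℝ := fun j => 3 * K * Real.sqrt (2 ^ j)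
  have hinj : Function.Injective fun k : ℕ => (k : ℤ) - n₀ := fun k l h => by
    simpa using h
  have hlt : ∀ {j k : ℕ}, j < J → k ∈ B j → 1 ≤ k ∧ k < 2 ^ J := by
    intro j k hj hk
    have hk' := Finset.mem_Ico.1 hk
    exact ⟨Nat.one_le_two_pow.trans hk'.1,
      hk'.2.trans_le (Nat.pow_le_pow_right (by norm_num) hj)⟩
  have hS : ∀ i j, i ≠ j → Disjoint (S i) (S j) := by
    intro i j hij
    refine (Set.disjoint_image_iff hinj).2 (Finset.disjoint_coe.2 ?_)
    have key : ∀ i j, i < j → Disjoint (B i) (B j) := fun i j h => by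
      refine Finset.disjoint_left.2 fun k hk hk' => ?_
      have h1 := (Finset.mem_Ico.1 hk).2
      have h2 := (Finset.mem_Ico.1 hk').1
      have h3 : 2 ^ (i + 1) ≤ 2 ^ j := Nat.pow_le_pow_right (by norm_num) h
      omega
    rcases lt_or_gt_of_ne hij with h | h
    · exact key i j h
    · exact (key j i h).symm
  have hT : ∀ j < J, Disjoint (S j) T := by
    intro j hj
    refine Set.disjoint_left.2 ?_
    rintro _ ⟨k, hk, rfl⟩ hkT
    have h := hlt hj hk
    have h2 : (k : ℤ) < 2 ^ J := by exact_mod_cast h.2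
    simp only [T, Set.mem_ofPred_eq] at hkT
    omega
  have hV : ∀ j, Measurable[coordSigma (S j)] (V j) := fun j =>
    Finset.measurable_sum (m := coordSigma (S j)) _ fun k hk =>
      (measurable_coord (Set.mem_image_of_mem _ hk)).const_mul (φ j (e k) * a n₀)
  have hR : ∀ j < J, Measurable[coordSigma T] (R j) := by
    intro j hj
    refine Finset.measurable_sum (m := coordSigma T) _ fun k hk => ?_
    refine (measurable_causalSeries_coordSigma fun m hm => ?_).const_mul (φ j (e k))
    have hk' := hlt hj hk
    have hne : m + k ≠ n₀ := fun h => hm (by simp [h])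
    rw [Function.update_of_ne hne] at hm
    have hfar : ¬ (m + k < n₀ + 2 ^ J ∧ n₀ < m + k + 2 ^ J) := fun h =>
      hm (hiso _ hne h.1 h.2)
    have hcast : ((2 ^ J : ℕ) : ℤ) = (2 : ℤ) ^ J := by push_cast; rfl
    simp only [T, Set.mem_ofPred_eq, ← hcast]
    generalize 2 ^ J = w at *
    omega
  have hp : ∀ j r, gaussianPath {ω | |V j ω + r| < t j}
      ≤ ENNReal.ofReal (1 - gaussianTail (3 * K * Real.sqrt 2 / a n₀)) := by
    intro j r
    set s : ℝ := a n₀ * Real.sqrt (2 ^ j) / Real.sqrt 2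
    have hs : 0 < s := by positivity
    have hlaw := map_sum_coord (B j) (fun k => φ j (e k) * a n₀) hinj
    set v : NNReal := ∑ k ∈ B j, Real.toNNReal ((φ j (e k) * a n₀) ^ 2)
    have hv : s ^ 2 ≤ v := by
      have hvs : (v : ℝ) = a n₀ ^ 2 * ∑ k ∈ B j, φ j (e k) ^ 2 := by
        simp only [v, NNReal.coe_sum, Finset.mul_sum]
        refine Finset.sum_congr rfl fun k _ => ?_
        rw [Real.coe_toNNReal _ (sq_nonneg _)]
        ring
      rw [hvs, div_pow, mul_pow, Real.sq_sqrt (by positivity), Real.sq_sqrt (by positivity),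
        mul_div_assoc]
      exact mul_le_mul_of_nonneg_left (hφsum j) (sq_nonneg _)
    have hts : t j / s = 3 * K * Real.sqrt 2 / a n₀ := by
      simp only [t, s]
      have : Real.sqrt (2 ^ j) ≠ 0 := by positivity
      field_simp
    have hm : MeasurableSet {x : ℝ | |x + r| < t j} :=
      measurableSet_lt (by fun_prop) measurable_const
    have hVm : Measurable (V j) := (hV j).mono (coordSigma_le _) le_rfl
    have h1 := gaussianReal_abs_add_lt_le hs (t := t j) (by positivity) hv r
    rw [hts, ← hlaw] at h1
    rw [show {ω | |V j ω + r| < t j} = V j ⁻¹' {x | |x + r| < t j} from rfl,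
      ← Measure.map_apply hVm hm]
    have := Measure.isProbabilityMeasure_map (μ := gaussianPath) hVm.aemeasurable
    exact (ENNReal.le_ofReal_iff_toReal_le (measure_ne_top _ _)
      (sub_nonneg.2 (gaussianTail_le_one _))).2 h1
  refine (measure_mono_ae ?_).trans (measure_forall_abs_add_lt_le hS hT hV hR hp)
  have hae : ∀ᵐ ω ∂gaussianPath, ∀ k ≤ n₀, causalSeries (fun m => a (m + k)) 0 ω
      = a n₀ * ω (k - n₀) + causalSeries (fun m => Function.update a n₀ 0 (m + k)) 0 ω :=
    ae_all_iff.2 fun k => eventually_imp_distrib_left.2 fun hk =>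
      causalSeries_eq_add_update ha hk
  filter_upwards [hae] with ω hω hlow j hj
  have hsplit : V j ω + R j ω = φ j (pastDft a (2 ^ (j + 1)) θ ω - pastDft a (2 ^ j) θ ω) := by
    unfold pastDft
    rw [← Finset.sum_Ico_eq_sub _ (Nat.pow_le_pow_right (by norm_num) j.le_succ), map_sum,
      ← Finset.sum_add_distrib]
    refine Finset.sum_congr rfl fun k hk => ?_
    rw [hω k ((hlt hj hk).2.le.trans hJ), ← Complex.real_smul, map_smul, smul_eq_mul]
    ring
  have h1 := hlow (2 ^ (j + 1)) Nat.one_le_two_pow (Nat.pow_le_pow_right (by norm_num) hj)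
  have h2 := hlow (2 ^ j) Nat.one_le_two_pow (Nat.pow_le_pow_right (by norm_num) hj.le)
  -- The bounds at both ends of the block give `K √(2 ^ (j + 1)) + K √(2 ^ j) ≤ 3 K √(2 ^ j)`.
  have hsqrt : Real.sqrt ((2 ^ (j + 1) : ℕ) : ℝ) ≤ 2 * Real.sqrt (2 ^ j) := by
    rw [Real.sqrt_le_left (by positivity), mul_pow, Real.sq_sqrt (by positivity)]
    push_cast
    rw [pow_succ]
    nlinarith [pow_pos (two_pos : (0 : ℝ) < 2) j]
  push_cast at h2
  rw [hsplit]
  calc |φ j (pastDft a (2 ^ (j + 1)) θ ω - pastDft a (2 ^ j) θ ω)|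
      ≤ ‖pastDft a (2 ^ (j + 1)) θ ω - pastDft a (2 ^ j) θ ω‖ := hφ j _
    _ ≤ ‖pastDft a (2 ^ (j + 1)) θ ω‖ + ‖pastDft a (2 ^ j) θ ω‖ := norm_sub_le _ _
    _ < K * Real.sqrt ((2 ^ (j + 1) : ℕ) : ℝ) + K * Real.sqrt (2 ^ j) := add_lt_add h1 h2
    _ ≤ K * (2 * Real.sqrt (2 ^ j)) + K * Real.sqrt (2 ^ j) := by gcongr
    _ = t j := by simp only [t]; ring

/-! ### Sparse coefficients -/

/-- For every sequence of required numbers of trials there are positions, isolated from each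
other at the corresponding dyadic scales. -/
theorem exists_isolated_positions (J₀ : ℕ → ℕ) : ∃ J x : ℕ → ℕ, (∀ l, J₀ l ≤ J l) ∧
    StrictMono x ∧ (∀ l, 2 ^ J l ≤ x l) ∧
    ∀ l i, x i ≠ x l → ¬ (x i < x l + 2 ^ J l ∧ x l < x i + 2 ^ J l) := by
  set J : ℕ → ℕ := fun l => ∑ i ∈ Finset.range (l + 1), J₀ i
  set x : ℕ → ℕ := fun l => ∑ i ∈ Finset.range (l + 2), 2 ^ J i
  have hJ : Monotone J := monotone_nat_of_le_succ fun l => by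
    simp only [J, Finset.sum_range_succ _ (l + 1)]
    omega
  have hx : ∀ l, x (l + 1) = x l + 2 ^ J (l + 2) := fun l => Finset.sum_range_succ _ _
  have hxm : StrictMono x := strictMono_nat_of_lt_succ fun l => by
    rw [hx]
    have := Nat.one_le_two_pow (n := J (l + 2))
    omega
  have hpow : ∀ {i l}, i ≤ l → 2 ^ J i ≤ 2 ^ J l := fun h =>
    Nat.pow_le_pow_right (by norm_num) (hJ h)
  refine ⟨J, x, fun l => ?_, hxm, fun l => ?_, ?_⟩
  · simp only [J, Finset.sum_range_succ]
    omega
  · exact Finset.single_le_sum (f := fun i => 2 ^ J i) (fun i _ => Nat.zero_le _)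
      (Finset.mem_range.2 (by omega))
  · rintro l i hne ⟨h1, h2⟩
    rcases lt_trichotomy i l with h | rfl | h
    · obtain ⟨p, rfl⟩ : ∃ p, l = p + 1 := ⟨l - 1, by omega⟩
      have h3 := hxm.monotone (Nat.lt_succ_iff.1 h)
      have h4 := hx p
      have h5 := hpow (show p + 1 ≤ p + 2 by omega)
      omega
    · exact hne rfl
    · have h3 := hxm.monotone (Nat.succ_le_of_lt h)
      have h4 := hx l
      have h5 := hpow (show l ≤ l + 2 by omega)
      simp only [Nat.succ_eq_add_one] at h3
      omega

/-- There are absolutely summable coefficients for which the normalized conditional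
expectations `E[S_n(θ) | F₀] / √n` are almost surely unbounded, at every frequency `θ`. -/
theorem exists_coefficients : ∃ a : ℕ → ℝ, (Summable fun m => |a m|) ∧
    ∀ θ : ℝ, ∀ᵐ ω ∂gaussianPath, ∀ K : ℝ, ∃ n : ℕ, 1 ≤ n ∧
      K * Real.sqrt n ≤ ‖pastDft a n θ ω‖ := by
  set b : ℕ → ℝ := fun l => (1 / 2) ^ l
  set q : ℕ → ℝ := fun l => gaussianTail (3 * (l : ℝ) * Real.sqrt 2 / b l)
  have hq : ∀ l, ∃ j : ℕ, (1 - q l) ^ j < (1 / 2) ^ l := fun l =>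
    exists_pow_lt_of_lt_one (by positivity) (sub_lt_self _ (gaussianTail_pos _))
  choose J₀ hJ₀ using hq
  obtain ⟨J, x, hJ, hx, hxJ, hiso⟩ := exists_isolated_positions J₀
  have hax : ∀ l, Function.extend x b 0 (x l) = b l := hx.injective.extend_apply _ _
  have hsum : Summable fun m => |Function.extend x b 0 m| := by
    refine (hx.injective.summable_iff fun m hm => ?_).1 ?_
    · rw [Function.extend_apply' _ _ _ hm, Pi.zero_apply, abs_zero]
    · simp only [Function.comp_def, hax]
      refine summable_geometric_two.congr fun l => ?_
      exact (abs_of_pos (by positivity)).symm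
  refine ⟨Function.extend x b 0, hsum, fun θ => ?_⟩
  set a := Function.extend x b 0
  set E : ℕ → Set (ℤ → ℝ) := fun l =>
    {ω | ∀ n : ℕ, 1 ≤ n → n ≤ 2 ^ J l → ‖pastDft a n θ ω‖ < l * Real.sqrt n}
  have hE : ∀ l, gaussianPath (E l) ≤ ENNReal.ofReal ((1 / 2) ^ l) := by
    intro l
    refine (measure_forall_pastDft_lt_le hsum (hxJ l) (fun i hne h1 h2 => ?_)
      (by rw [hax]; positivity) l.cast_nonneg θ).trans ?_
    · by_cases hi : ∃ i', x i' = i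
      · obtain ⟨i', rfl⟩ := hi
        exact absurd ⟨h1, h2⟩ (hiso l i' hne)
      · exact Function.extend_apply' _ _ _ hi
    · rw [hax, ← ENNReal.ofReal_pow (sub_nonneg.2 (gaussianTail_le_one _))]
      refine ENNReal.ofReal_le_ofReal (le_trans ?_ (hJ₀ l).le)
      exact pow_le_pow_of_le_one (sub_nonneg.2 (gaussianTail_le_one _))
        (sub_le_self _ (gaussianTail_pos _).le) (hJ l)
  have hfin : ∑' l, gaussianPath (E l) ≠ ⊤ :=
    ne_top_of_le_ne_top summable_geometric_two.tsum_ofReal_ne_top (ENNReal.tsum_le_tsum hE)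
  filter_upwards [ae_eventually_notMem hfin] with ω hω K
  obtain ⟨l, hl, hKl⟩ := (hω.and (eventually_ge_atTop ⌈K⌉₊)).exists
  simp only [E, Set.mem_ofPred_eq, not_forall, not_lt] at hl
  obtain ⟨n, hn1, -, hn⟩ := hl
  refine ⟨n, hn1, le_trans ?_ hn⟩
  have : K ≤ l := (Nat.le_ceil K).trans (by exact_mod_cast hKl)
  gcongr

/-! ### Conditional expectation of the Fourier transform -/

/-- The part of the discrete Fourier transform of a linear process that depends on the
coordinates with index `> 0`. -/
noncomputable def futureDft (c : ℕ → ℝ) (n : ℕ) (θ : ℝ) (ω : ℤ → ℝ) : ℂ :=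
  ∑ k ∈ Finset.range n, ((∑ m ∈ Finset.range k, c m * ω (k - m) : ℝ) : ℂ) *
    Complex.exp (Complex.I * (k : ℂ) * (θ : ℂ))

theorem dft_ae_eq {c : ℕ → ℝ} (hc : Summable fun m => |c m|) (n : ℕ) (θ : ℝ) :
    dft (process shift (causalSeries c 0)) n θ
      =ᵐ[gaussianPath] futureDft c n θ + pastDft c n θ := by
  have h := ae_all_iff.2 fun k : ℕ => ae_summable_causalSeries hc k
  filter_upwards [h] with ω hω
  simp only [dft, futureDft, pastDft, Pi.add_apply, ← Finset.sum_add_distrib]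
  refine Finset.sum_congr rfl fun k _ => ?_
  rw [process_causalSeries, causalSeries_eq_sum_add (hω k) k, sub_self]
  push_cast
  ring

theorem measurable_futureDft (c : ℕ → ℝ) (n : ℕ) (θ : ℝ) :
    Measurable[coordSigma (Set.Ioi 0)] (futureDft c n θ) := by
  refine Finset.measurable_sum (m := coordSigma (Set.Ioi 0)) _ fun k _ => ?_
  have : Measurable[coordSigma (Set.Ioi 0)]
      fun ω : ℤ → ℝ => ∑ m ∈ Finset.range k, c m * ω (k - m) :=
    Finset.measurable_sum (m := coordSigma (Set.Ioi 0)) _ fun m hm =>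
      (measurable_coord (by
        have := Finset.mem_range.1 hm
        simp only [Set.mem_Ioi]
        omega)).const_mul (c m)
  exact (Complex.measurable_ofReal.comp this).mul_const _

theorem measurable_pastDft (c : ℕ → ℝ) (n : ℕ) (θ : ℝ) :
    Measurable[coordSigma (Set.Iic 0)] (pastDft c n θ) := by
  refine Finset.measurable_sum (m := coordSigma (Set.Iic 0)) _ fun k _ => ?_
  have : Measurable[coordSigma (Set.Iic 0)] (causalSeries (fun m => c (m + k)) 0) :=
    measurable_causalSeries_coordSigma fun m _ => by simp
  exact (Complex.measurable_ofReal.comp this).mul_const _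

theorem integrable_pastDft {c : ℕ → ℝ} (hc : Summable fun m => |c m|) (n : ℕ) (θ : ℝ) :
    Integrable (pastDft c n θ) gaussianPath :=
  integrable_finsetSum _ fun k _ =>
    (((memLp_causalSeries (summable_abs_nat_add hc k) 0).integrable
      (by norm_num)).ofReal).mul_const _

theorem integrable_sum_coord (c : ℕ → ℝ) (k : ℕ) :
    Integrable (fun ω : ℤ → ℝ => ∑ m ∈ Finset.range k, c m * ω (k - m)) gaussianPath :=
  integrable_finsetSum _ fun _ _ => ((memLp_coord _).integrable (by norm_num)).const_mul _

theorem integrable_futureDft (c : ℕ → ℝ) (n : ℕ) (θ : ℝ) :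
    Integrable (futureDft c n θ) gaussianPath :=
  integrable_finsetSum _ fun k _ => ((integrable_sum_coord c k).ofReal).mul_const _

theorem integral_futureDft (c : ℕ → ℝ) (n : ℕ) (θ : ℝ) :
    ∫ ω, futureDft c n θ ω ∂gaussianPath = 0 := by
  unfold futureDft
  rw [integral_finsetSum _ fun k _ => ((integrable_sum_coord c k).ofReal).mul_const _]
  refine Finset.sum_eq_zero fun k _ => ?_
  rw [integral_mul_const, integral_complex_ofReal,
    integral_finsetSum _ fun _ _ => ((memLp_coord _).integrable (by norm_num)).const_mul _]
  simp [integral_const_mul, integral_coord]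

theorem disjoint_Ioi_Iic_zero : Disjoint (Set.Ioi (0 : ℤ)) (Set.Iic 0) :=
  Set.disjoint_left.2 fun _ hx hx' => (Set.mem_Ioi.1 hx).not_ge (Set.mem_Iic.1 hx')

theorem condExp_dft {c : ℕ → ℝ} (hc : Summable fun m => |c m|) (n : ℕ) (θ : ℝ) :
    gaussianPath[dft (process shift (causalSeries c 0)) n θ | coordSigma (Set.Iic 0)]
      =ᵐ[gaussianPath] pastDft c n θ := by
  have hF := coordSigma_le (Set.Iic 0)
  have hU := condExp_indep_eq (coordSigma_le (Set.Ioi 0)) hF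
    (measurable_futureDft c n θ).stronglyMeasurable (indep_coordSigma disjoint_Ioi_Iic_zero)
  filter_upwards [condExp_congr_ae (m := coordSigma (Set.Iic 0)) (dft_ae_eq hc n θ), hU,
    condExp_add (integrable_futureDft c n θ) (integrable_pastDft hc n θ)
      (coordSigma (Set.Iic 0))] with ω h1 h2 h3
  rw [h1, h3, Pi.add_apply, h2, integral_futureDft, zero_add,
    condExp_of_stronglyMeasurable hF (measurable_pastDft c n θ).stronglyMeasurable
      (integrable_pastDft hc n θ)]

/-- A sequence that is unbounded after the first term is unbounded arbitrarily far. -/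
theorem exists_ge_of_unbounded {f : ℕ → ℝ} (h : ∀ K : ℝ, ∃ n : ℕ, 1 ≤ n ∧ K ≤ f n) (K : ℝ)
    (N : ℕ) : ∃ n, N ≤ n ∧ 1 ≤ n ∧ K ≤ f n := by
  obtain ⟨n, hn1, hn⟩ := h (|K| + ∑ i ∈ Finset.range N, |f i| + 1)
  have hs : 0 ≤ ∑ i ∈ Finset.range N, |f i| := Finset.sum_nonneg fun _ _ => abs_nonneg _
  refine ⟨n, ?_, hn1, by linarith [le_abs_self K]⟩
  by_contra hlt
  have := Finset.single_le_sum (f := fun i => |f i|) (fun i _ => abs_nonneg _)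
    (Finset.mem_range.2 (not_le.1 hlt))
  linarith [le_abs_self (f n), abs_nonneg K]

theorem unbounded_pastDft_div_sqrt {c : ℕ → ℝ} {θ : ℝ} {ω : ℤ → ℝ}
    (h : ∀ K : ℝ, ∃ n : ℕ, 1 ≤ n ∧ K * Real.sqrt n ≤ ‖pastDft c n θ ω‖) (K : ℝ) (N : ℕ) :
    ∃ n, N ≤ n ∧ 1 ≤ n ∧ K ≤ ‖pastDft c n θ ω‖ / Real.sqrt n := by
  refine exists_ge_of_unbounded (f := fun n => ‖pastDft c n θ ω‖ / Real.sqrt n)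
    (fun K => ?_) K N
  obtain ⟨n, hn1, hn⟩ := h K
  have : (0 : ℝ) < n := by exact_mod_cast hn1
  exact ⟨n, hn1, (le_div_iff₀ (Real.sqrt_pos.2 this)).2 hn⟩

theorem limsup_condExp_dft_eq_top {c : ℕ → ℝ} (hc : Summable fun m => |c m|) {θ : ℝ}
    (h : ∀ᵐ ω ∂gaussianPath, ∀ K : ℝ, ∃ n : ℕ, 1 ≤ n ∧ K * Real.sqrt n ≤ ‖pastDft c n θ ω‖) :
    ∀ᵐ ω ∂gaussianPath, limsup (fun n : ℕ => ENNReal.ofReal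
      (‖(gaussianPath[dft (process shift (causalSeries c 0)) n θ | coordSigma (Set.Iic 0)]) ω‖
        / Real.sqrt n)) atTop = ⊤ := by
  filter_upwards [h, ae_all_iff.2 fun n => condExp_dft hc n θ] with ω hω hce
  simp only [hce]
  refine ENNReal.eq_top_of_forall_nnreal_le fun K => ?_
  refine le_limsup_of_frequently_le (frequently_atTop.2 fun N => ?_) (by isBoundedDefault)
  obtain ⟨n, hN, -, hn⟩ := unbounded_pastDft_div_sqrt hω K N
  refine ⟨n, hN, ?_⟩
  rw [← ENNReal.ofReal_coe_nnreal]
  exact ENNReal.ofReal_le_ofReal hn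

/-! ### Symmetry of the future given the past -/

/-- The sign change of all coordinates with index `> 0`. -/
noncomputable def flipFuture (ω : ℤ → ℝ) (i : ℤ) : ℝ := if 0 < i then -ω i else ω i

theorem measurePreserving_flipFuture : MeasurePreserving flipFuture gaussianPath gaussianPath := by
  have hf : ∀ i : ℤ, Measurable fun x : ℝ => if 0 < i then -x else x := fun i => by
    split_ifs <;> fun_prop
  refine ⟨measurable_pi_lambda _ fun i => (hf i).comp (measurable_pi_apply i), ?_⟩
  have h := Measure.infinitePi_map_pi (fun _ : ℤ => gaussianReal 0 1) hf
  have hg : ∀ i : ℤ, (gaussianReal 0 1).map (fun x : ℝ => if 0 < i then -x else x)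
      = gaussianReal 0 1 := fun i => by
    split_ifs
    · rw [gaussianReal_map_neg, neg_zero]
    · exact Measure.map_id
  simp only [hg] at h
  exact h

theorem pastDft_flipFuture (c : ℕ → ℝ) (n : ℕ) (θ : ℝ) (ω : ℤ → ℝ) :
    pastDft c n θ (flipFuture ω) = pastDft c n θ ω := by
  have h : ∀ m : ℕ, ¬ (0 : ℤ) < 0 - m := fun m => by omega
  simp only [pastDft, causalSeries, flipFuture, h, if_false]

theorem futureDft_flipFuture (c : ℕ → ℝ) (n : ℕ) (θ : ℝ) (ω : ℤ → ℝ) :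
    futureDft c n θ (flipFuture ω) = -futureDft c n θ ω := by
  unfold futureDft
  rw [← Finset.sum_neg_distrib]
  refine Finset.sum_congr rfl fun k _ => ?_
  rw [← neg_mul, ← Complex.ofReal_neg, ← Finset.sum_neg_distrib]
  congr 2
  refine Finset.sum_congr rfl fun m hm => ?_
  have : (0 : ℤ) < k - m := by
    have := Finset.mem_range.1 hm
    omega
  rw [flipFuture, if_pos this, mul_neg]

/-- Events of the past are not affected by a sign change of the future. -/
theorem flipFuture_preimage {A : Set (ℤ → ℝ)} (hA : MeasurableSet[coordSigma (Set.Iic 0)] A) :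
    flipFuture ⁻¹' A = A := by
  have h : coordSigma (Set.Iic 0)
      = MeasurableSpace.pi.comap (fun (ω : ℤ → ℝ) (i : Set.Iic (0 : ℤ)) => ω i) := by
    unfold MeasurableSpace.pi
    rw [MeasurableSpace.comap_iSup]
    simp only [MeasurableSpace.comap_comp]
    rfl
  rw [h] at hA
  obtain ⟨B, -, rfl⟩ := hA
  ext ω
  have : (fun i : Set.Iic (0 : ℤ) => flipFuture ω i) = fun i : Set.Iic (0 : ℤ) => ω i :=
    funext fun i => if_neg (not_lt.2 i.2)
  simp only [Set.mem_preimage, this]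

theorem condExp_comp_flipFuture {Y : (ℤ → ℝ) → ℝ} (hY : Integrable Y gaussianPath) :
    gaussianPath[Y ∘ flipFuture | coordSigma (Set.Iic 0)]
      =ᵐ[gaussianPath] gaussianPath[Y | coordSigma (Set.Iic 0)] := by
  have hF := coordSigma_le (Set.Iic 0)
  have hφ := measurePreserving_flipFuture
  refine (ae_eq_condExp_of_forall_setIntegral_eq hF (hφ.integrable_comp_of_integrable hY)
    (fun s _ _ => integrable_condExp.integrableOn) (fun s hs _ => ?_)
    stronglyMeasurable_condExp.aestronglyMeasurable).symm
  rw [setIntegral_condExp hF hY hs]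
  have hsm := hF s hs
  have h1 : ∫ ω in s, Y ω ∂gaussianPath.map flipFuture
      = ∫ ω in flipFuture ⁻¹' s, Y (flipFuture ω) ∂gaussianPath :=
    setIntegral_map hsm (by rw [hφ.map_eq]; exact hY.1) hφ.measurable.aemeasurable
  rw [hφ.map_eq, flipFuture_preimage hs] at h1
  exact h1

theorem measurable_dft (X : (ℤ → ℝ) → ℝ) (hX : Measurable X) (n : ℕ) (θ : ℝ) :
    Measurable (dft (process shift X) n θ) := by
  unfold dft
  refine Finset.measurable_sum _ fun k _ => ?_
  have : Measurable (process shift X k) := by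
    rw [show process shift X k = fun ω => X fun i => ω (i + k) from funext (process_shift X k)]
    fun_prop
  fun_prop

/-- Given the past, with probability at least `1/2` the modulus `|S_n(θ)|` is at least that of the
conditional mean `E[S_n(θ) | F₀]`: the future part is symmetric, and of two numbers
`c + w` and `c - w` one has absolute value at least `|c|`. -/
theorem half_le_condExp_dft {c : ℕ → ℝ} (hc : Summable fun m => |c m|) (n : ℕ) (θ K : ℝ) :
    ∀ᵐ ω ∂gaussianPath, K ≤ ‖pastDft c n θ ω‖ → 1 / 2 ≤ (gaussianPath[
      {ω | K ≤ ‖dft (process shift (causalSeries c 0)) n θ ω‖}.indicator (fun _ => (1 : ℝ)) |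
        coordSigma (Set.Iic 0)]) ω := by
  have hF := coordSigma_le (Set.Iic 0)
  have hφ := measurePreserving_flipFuture
  set X := dft (process shift (causalSeries c 0)) n θ
  set Y : (ℤ → ℝ) → ℝ := {ω | K ≤ ‖X ω‖}.indicator fun _ => 1
  set G : (ℤ → ℝ) → ℝ := {ω | K ≤ ‖pastDft c n θ ω‖}.indicator fun _ => 1
  have hXm : Measurable X := measurable_dft _ (measurable_causalSeries c 0) n θ
  have hYi : Integrable Y gaussianPath :=
    (integrable_const 1).indicator (measurableSet_le measurable_const hXm.norm)
  have hYi' : Integrable (Y ∘ flipFuture) gaussianPath := hφ.integrable_comp_of_integrable hYi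
  have hGset : MeasurableSet[coordSigma (Set.Iic 0)] {ω | K ≤ ‖pastDft c n θ ω‖} :=
    measurable_norm.comp (measurable_pastDft c n θ) measurableSet_Ici
  have hGi : Integrable G gaussianPath := (integrable_const 1).indicator (hF _ hGset)
  have hGm : StronglyMeasurable[coordSigma (Set.Iic 0)] G :=
    stronglyMeasurable_const.indicator hGset
  have hle : G ≤ᵐ[gaussianPath] Y + Y ∘ flipFuture := by
    have h1 := dft_ae_eq hc n θ
    filter_upwards [h1, hφ.quasiMeasurePreserving.ae h1] with ω h1 h2
    have h1' : X ω = futureDft c n θ ω + pastDft c n θ ω := h1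
    have h2' : X (flipFuture ω) = -futureDft c n θ ω + pastDft c n θ ω := by
      rw [← futureDft_flipFuture, ← pastDft_flipFuture]; exact h2
    have h0 : ∀ z, 0 ≤ Y z := fun z => Set.indicator_nonneg (fun _ _ => zero_le_one) z
    by_cases hG : K ≤ ‖pastDft c n θ ω‖
    · have hor : K ≤ ‖X ω‖ ∨ K ≤ ‖X (flipFuture ω)‖ := by
        by_contra! hcon
        have h3 := norm_add_le (X ω) (X (flipFuture ω))
        rw [show X ω + X (flipFuture ω) = 2 * pastDft c n θ ω by rw [h1', h2']; ring, norm_mul,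
          Complex.norm_two] at h3
        linarith
      rw [show G ω = 1 from Set.indicator_of_mem (s := {ω | K ≤ ‖pastDft c n θ ω‖}) hG _]
      rcases hor with h | h
      · have : Y ω = 1 := Set.indicator_of_mem (s := {ω | K ≤ ‖X ω‖}) h _
        simp only [Pi.add_apply, Function.comp_apply, this]
        linarith [h0 (flipFuture ω)]
      · have : Y (flipFuture ω) = 1 := Set.indicator_of_mem (s := {ω | K ≤ ‖X ω‖}) h _
        simp only [Pi.add_apply, Function.comp_apply, this]
        linarith [h0 ω]
    · rw [show G ω = 0 from Set.indicator_of_notMem (s := {ω | K ≤ ‖pastDft c n θ ω‖}) hG _]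
      exact add_nonneg (h0 _) (h0 _)
  filter_upwards [condExp_mono (m := coordSigma (Set.Iic 0)) hGi (hYi.add hYi') hle,
    condExp_add hYi hYi' (coordSigma (Set.Iic 0)), condExp_comp_flipFuture hYi] with ω h1 h2 h3 hG
  rw [h2, Pi.add_apply, h3, condExp_of_stronglyMeasurable hF hGm hGi,
    show G ω = 1 from Set.indicator_of_mem (s := {ω | K ≤ ‖pastDft c n θ ω‖}) hG _] at h1
  linarith

/-! ### Absence of limits in distribution under the conditional laws -/

/-- A limit in distribution would be tight, and the portmanteau theorem on the closed sets
`{|z| ≥ K}` would transfer this to the sequence. -/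
theorem not_hasLimitInDistribution_of_frequently {Ω : Type*} [MeasurableSpace Ω]
    {Q : ProbabilityMeasure Ω} {Z : ℕ → Ω → ℂ}
    (h : ∀ K : ℕ, ∃ᶠ n in atTop, 1 / 2 ≤ (Q : Measure Ω).real {z | (K : ℝ) ≤ ‖Z n z‖}) :
    ¬ HasLimitInDistribution Q Z := by
  rintro ⟨ν, hν⟩
  have hclosed : ∀ K : ℕ, IsClosed {z : ℂ | (K : ℝ) ≤ ‖z‖} := fun K =>
    isClosed_le continuous_const continuous_norm
  have htight : Tendsto (fun K : ℕ => (ν : Measure ℂ) {z : ℂ | (K : ℝ) ≤ ‖z‖}) atTop (𝓝 0) := by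
    have h0 := tendsto_measure_iInter_atTop (μ := (ν : Measure ℂ))
      (s := fun K : ℕ => {z : ℂ | (K : ℝ) ≤ ‖z‖})
      (fun K => (hclosed K).measurableSet.nullMeasurableSet)
      (fun K L hKL z hz => le_trans (by exact_mod_cast hKL : (K : ℝ) ≤ L) hz)
      ⟨0, measure_ne_top _ _⟩
    have hempty : ⋂ K : ℕ, {z : ℂ | (K : ℝ) ≤ ‖z‖} = ∅ := by
      refine Set.eq_empty_of_forall_notMem fun z hz => ?_
      obtain ⟨K, hK⟩ := exists_nat_gt ‖z‖
      exact absurd (Set.mem_iInter.1 hz K) (not_le.2 hK)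
    rwa [hempty, measure_empty] at h0
  obtain ⟨K, hK⟩ := (htight.eventually_lt_const
    (show (0 : ENNReal) < ENNReal.ofReal (1 / 4) by simp)).exists
  have hlim := ProbabilityMeasure.limsup_measure_closed_le_of_tendsto hν.tendsto (hclosed K)
  have hge : ENNReal.ofReal (1 / 2) ≤ limsup (fun n =>
      ((Q : Measure Ω).map (Z n)) {z : ℂ | (K : ℝ) ≤ ‖z‖}) atTop := by
    refine le_limsup_of_frequently_le ((h K).mono fun n hn => ?_) (by isBoundedDefault)
    rw [Measure.map_apply_of_aemeasurable (hν.forall_aemeasurable n) (hclosed K).measurableSet]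
    exact ENNReal.ofReal_le_of_le_toReal hn
  have hid : ((ν : Measure ℂ).map id) {z : ℂ | (K : ℝ) ≤ ‖z‖} < ENNReal.ofReal (1 / 4) := by
    rwa [Measure.map_id]
  have hlt := (hge.trans hlim).trans_lt hid
  rw [ENNReal.ofReal_lt_ofReal_iff (by norm_num)] at hlt
  norm_num at hlt

theorem not_hasLimitInDistribution_normalizedDft {c : ℕ → ℝ} (hc : Summable fun m => |c m|)
    {θ : ℝ}
    (h : ∀ᵐ ω ∂gaussianPath, ∀ K : ℝ, ∃ n : ℕ, 1 ≤ n ∧ K * Real.sqrt n ≤ ‖pastDft c n θ ω‖)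
    {Q : (ℤ → ℝ) → ProbabilityMeasure (ℤ → ℝ)}
    (hQ : IsDecomposition (coordSigma (Set.Iic 0)) gaussianPath Q) :
    ∀ᵐ ω ∂gaussianPath, ¬ HasLimitInDistribution (Q ω)
      fun n => normalizedDft (process shift (causalSeries c 0)) n θ := by
  set X := dft (process shift (causalSeries c 0))
  have hset : ∀ (n : ℕ) (K : ℝ), MeasurableSet {z | K ≤ ‖X n θ z‖} := fun n K =>
    measurableSet_le measurable_const (measurable_dft _ (measurable_causalSeries c 0) n θ).norm
  have hver : ∀ᵐ ω ∂gaussianPath, ∀ n K : ℕ,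
      K * Real.sqrt n ≤ ‖pastDft c n θ ω‖ →
        1 / 2 ≤ (Q ω : Measure (ℤ → ℝ)).real {z | K * Real.sqrt n ≤ ‖X n θ z‖} := by
    refine ae_all_iff.2 fun n => ae_all_iff.2 fun K => ?_
    filter_upwards [half_le_condExp_dft hc n θ (K * Real.sqrt n),
      (hQ ({z | K * Real.sqrt n ≤ ‖X n θ z‖}.indicator fun _ => 1)
        (measurable_const.indicator (hset n _))
        ((integrable_const 1).indicator (hset n _))).2] with ω h1 h2 hK
    have h3 := h1 hK
    rw [← h2, integral_indicator_const _ (hset n _)] at h3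
    simpa using h3
  filter_upwards [h, hver] with ω hω hQω
  refine not_hasLimitInDistribution_of_frequently fun K => frequently_atTop.2 fun N => ?_
  obtain ⟨n, hN, hn1, hn⟩ := unbounded_pastDft_div_sqrt hω K N
  have hpos : 0 < Real.sqrt n := Real.sqrt_pos.2 (by exact_mod_cast hn1)
  refine ⟨n, hN, (hQω n K ((le_div_iff₀ hpos).1 hn)).trans_eq ?_⟩
  congr 1
  ext z
  simp only [Set.mem_ofPred_eq, normalizedDft, norm_div, Complex.norm_real, Real.norm_eq_abs,
    abs_of_pos hpos, le_div_iff₀ hpos, X]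

/-! ### Structural properties of the Gaussian linear process -/

theorem isRegularCondExp_gaussianPath (S : Set ℤ) :
    IsRegularCondExp (coordSigma S) gaussianPath := by
  refine ⟨fun ω => ⟨condExpKernel gaussianPath (coordSigma S) ω, inferInstance⟩,
    fun Y hYm hY => ⟨?_, ?_⟩⟩
  · exact hYm.stronglyMeasurable.integral_condExpKernel.measurable
  · exact (condExp_ae_eq_integral_condExpKernel (coordSigma_le S) hY).symm

theorem isTFiltration_shift : IsTFiltration (coordSigma (Set.Iic 0)) gaussianPath shift where
  measurePreserving := measurePreserving_shift
  le := coordSigma_le _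
  mono := by
    rw [sigmaAt_coordSigma]
    exact coordSigma_mono (Set.Iic_subset_Iic.2 zero_le_one)

theorem measurable_causalSeries_zero (c : ℕ → ℝ) :
    Measurable[coordSigma (Set.Iic 0)] (causalSeries c 0) :=
  measurable_causalSeries_coordSigma fun m _ => by simp

theorem peligradWuHypotheses_causalSeries {c : ℕ → ℝ} (hc : Summable fun m => |c m|) :
    PeligradWuHypotheses (coordSigma (Set.Iic 0)) gaussianPath shift (causalSeries c 0) where
  isTFiltration := isTFiltration_shift
  ergodic := ergodic_shift
  countablyGenerated := by
    rw [iSup_sigmaAt]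
    infer_instance
  adapted := measurable_causalSeries_zero c
  memLp := memLp_causalSeries hc 0
  regular := isRegularProcess_causalSeries hc
  spectralDensity := ⟨_, isSpectralDensity_causalSeries hc⟩

theorem isAdaptedLinearProcess_causalSeries {c : ℕ → ℝ} (hc : Summable fun m => |c m|) :
    IsAdaptedLinearProcess (coordSigma (Set.Iic 0)) gaussianPath shift (causalSeries c 0)
      (fun k ω => ω k) c where
  measurable := measurable_pi_apply
  iIndepFun := iIndepFun_coord
  identDistrib k := ⟨(measurable_pi_apply k).aemeasurable, (measurable_pi_apply 0).aemeasurable,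
    by rw [map_coord, map_coord]⟩
  memLp := memLp_coord 0
  centered := integral_coord 0
  shift k := by
    funext ω
    rw [process_shift]
    simp only [zero_add]
  past_eq := rfl
  summable := by
    refine Summable.of_norm_bounded_eventually_nat hc ?_
    have h1 := hc.tendsto_atTop_zero.eventually_le_const (zero_lt_one (α := ℝ))
    filter_upwards [h1] with m hm
    rw [norm_pow, Real.norm_eq_abs, sq]
    exact mul_le_of_le_one_left (abs_nonneg _) hm
  series k := by
    rw [process_causalSeries]
    exact tendsto_eLpNorm_causalSeries_sub hc k

end QuenchedDFT

theorem theorem4p3 :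
    ∃ (Ω : Type) (F₀ : MeasurableSpace Ω) (_ : MeasurableSpace Ω) (P : Measure Ω)
      (_ : IsProbabilityMeasure P) (T : Ω ≃ᵐ Ω) (X₀ : Ω → ℝ),
      QuenchedDFT.PeligradWuHypotheses F₀ P T X₀ ∧
      (∃ (ξ : ℤ → Ω → ℝ) (a : ℕ → ℝ), QuenchedDFT.IsAdaptedLinearProcess F₀ P T X₀ ξ a) ∧
      QuenchedDFT.IsRegularCondExp F₀ P ∧
      (∀ θ ∈ Set.Ico (0 : ℝ) (2 * Real.pi), ∀ᵐ ω ∂P,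
        limsup (fun n : ℕ => ENNReal.ofReal
          (‖(P[QuenchedDFT.dft (QuenchedDFT.process T X₀) n θ | F₀]) ω‖ / Real.sqrt n)) atTop
          = ⊤) ∧
      (∀ Q : Ω → ProbabilityMeasure Ω, QuenchedDFT.IsDecomposition F₀ P Q →
        ∀ θ ∈ Set.Ico (0 : ℝ) (2 * Real.pi), ∀ᵐ ω ∂P,
          ¬ QuenchedDFT.HasLimitInDistribution (Q ω)
            (fun n => QuenchedDFT.normalizedDft (QuenchedDFT.process T X₀) n θ)) := by
  obtain ⟨a, ha, hunb⟩ := QuenchedDFT.exists_coefficients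
  exact ⟨ℤ → ℝ, QuenchedDFT.coordSigma (Set.Iic 0), inferInstance, QuenchedDFT.gaussianPath,
    inferInstance, QuenchedDFT.shift, QuenchedDFT.causalSeries a 0,
    QuenchedDFT.peligradWuHypotheses_causalSeries ha,
    ⟨_, a, QuenchedDFT.isAdaptedLinearProcess_causalSeries ha⟩,
    QuenchedDFT.isRegularCondExp_gaussianPath _,
    fun θ _ => QuenchedDFT.limsup_condExp_dft_eq_top ha (hunb θ),
    fun Q hQ θ _ => QuenchedDFT.not_hasLimitInDistribution_normalizedDft ha (hunb θ) hQ⟩
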